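/- Let $k$ be a field; all algebras and Hopf algebras are commutative. For a $k$-vector space $V$ put $\hat T V=\prod_{n\ge 0}V^{\otimes n}$ and let $\psi_{p,q}\colon V^{\otimes (p+q)}\to V^{\otimes p}\otimes V^{\otimes q}$ be the canonical isomorphism. The cofree coalgebra $C(V)\subseteq\hat T V$ is the set of all $f=(f_n)_n$ for which $\Delta(f)=(\psi_{p,q}(f_{p+q}))_{p,q}\in\prod_{p,q}V^{\otimes p}\otimes V^{\otimes q}$ lies in (the image of) $\hat T V\otimes\hat T V$. If $V$ is a $k$-algebra, $\hat T V$ is a $k$-algebra with componentwise operations. Let $\alpha_1\colon k[G_1]\to k[H]$ and $\alpha_2\colon k[G_2]\to k[H]$ be morphisms of Hopf algebras over $k$, and let $V=k[G_1]\oplus k[G_2]$ (the product algebra). For a word $w=(i_1,\dots,i_n)\in\{1,2\}^n$ let $T_w=k[G_{i_1}]\otimes\cdots\otimes k[G_{i_n}]$ and let $f_w\in T_w$ be the component of $f\in\hat T V$ in the direct summand $T_w$ of $V^{\otimes n}$. Call $f$ coherent if for all words $u,v$ and all $i\in\{1,2\}$: (1) $(\mathrm{id}_{T_u}\otimes\Delta_{i}\otimes\mathrm{id}_{T_v})(f_{u\,i\,v})=f_{u\,i\,i\,v}$,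 where $\Delta_i$ is the comultiplication of $k[G_i]$; (2) $(\mathrm{id}_{T_u}\otimes\epsilon_{i}\otimes\mathrm{id}_{T_v})(f_{u\,i\,v})=f_{u\,v}$, where $\epsilon_i$ is the counit of $k[G_i]$; (3) $(\mathrm{id}_{T_u}\otimes\alpha_1\otimes\mathrm{id}_{T_v})(f_{u\,1\,v})=(\mathrm{id}_{T_u}\otimes\alpha_2\otimes\mathrm{id}_{T_v})(f_{u\,2\,v})$ in $T_u\otimes k[H]\otimes T_v$. Let $K=\{f\in C(k[G_1]\oplus k[G_2]) : f\text{ is coherent}\}$. Then $K$ is a $k$-subalgebra of $\hat T(k[G_1]\oplus k[G_2])$ and a commutative Hopf algebra, whose comultiplication $K\to K\otimes K$ is given by $f\mapsto\Delta(f)$, whose counit is $f\mapsto f_\emptyset\in k$, and whose antipode applies the antipodes of $k[G_1]$ and $k[G_2]$ to all tensor factors and reverses the order of the factors. The maps $p_i\colon K\to k[G_i]$, $p_i(f)=f_{(i)}$ $(i=1,2)$, given by the degree one component, are morphisms of Hopf algebras with $\alpha_1p_1=\alpha_2p_2$, and $(K,p_1,p_2)$ is the fibre product of $\alpha_1$ and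 $\alpha_2$ in the category of commutative Hopf algebras over $k$: for every commutative Hopf algebra $D$ over $k$ and all morphisms of Hopf algebras $q_1\colon D\to k[G_1]$, $q_2\colon D\to k[G_2]$ with $\alpha_1q_1=\alpha_2q_2$ there is a unique morphism of Hopf algebras $\varphi\colon D\to K$ with $p_1\varphi=q_1$ and $p_2\varphi=q_2$. -/

import Mathlib

open scoped TensorProduct

namespace HopfFibre

/-- The completed tensor space `T̂V = k × V × V^{⊗2} × ⋯`. When `V` is a commutative `k`-algebra, it
carries the componentwise algebra structure coming from the tensor power algebras `V^{⊗n}`. -/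
abbrev CompletedTensor (k V : Type*) [CommRing k] [AddCommGroup V] [Module k V] : Type _ :=
  (n : ℕ) → ⨂[k]^n V

section Cofree

variable (k V : Type*) [CommRing k] [AddCommGroup V] [Module k V]

/-- The canonical isomorphism `ψ_{p,q} : V^{⊗(p+q)} → V^{⊗p} ⊗ V^{⊗q}` (deconcatenation). -/
noncomputable def split (p q : ℕ) : (⨂[k]^(p + q) V) →ₗ[k] (⨂[k]^p V) ⊗[k] (⨂[k]^q V) :=
  (TensorPower.mulEquiv (R := k) (M := V) (n := p) (m := q)).symm.toLinearMap

/-- The canonical isomorphism `V^{⊗1} → V`. -/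
noncomputable def degreeOne : (⨂[k]^1 V) →ₗ[k] V :=
  (PiTensorProduct.subsingletonEquiv (R := k) (s := fun _ : Fin 1 => V) 0).toLinearMap

/-- The canonical isomorphism `V^{⊗(1+q)} → V ⊗ V^{⊗q}` splitting off the first factor. -/
noncomputable def splitHead (q : ℕ) : (⨂[k]^(1 + q) V) →ₗ[k] V ⊗[k] (⨂[k]^q V) :=
  (degreeOne k V).rTensor _ ∘ₗ split k V 1 q

/-- The cofree coalgebra `C(V)` on `V`, as the set of representative elements of `T̂V`: those `f`
for which the matrix `Δ(f) = (ψ_{p,q}(f_{p+q}))_{p,q}` in `∏_{p,q} V^{⊗p} ⊗ V^{⊗q}` lies in the image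
of `T̂V ⊗ T̂V`. -/
def cofree : Set (CompletedTensor k V) :=
  {f | ∃ t : CompletedTensor k V ⊗[k] CompletedTensor k V, ∀ p q : ℕ,
    TensorProduct.map (LinearMap.proj (R := k) (φ := fun n => ⨂[k]^n V) p)
      (LinearMap.proj (R := k) (φ := fun n => ⨂[k]^n V) q) t = split k V p q (f (p + q))}

end Cofree

section Coherent

variable {k : Type*} [Field k] {A : Fin 2 → Type*} [∀ i, CommRing (A i)] [∀ i, HopfAlgebra k (A i)]
  {B : Type*} [CommRing B] [HopfAlgebra k B]

/-- The projection of `(A 0 ⊕ A 1)^{⊗n}` onto its direct summand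
`T_w = A (w 0) ⊗ ⋯ ⊗ A (w (n - 1))`, for a word `w` of length `n` in the two indices. -/
noncomputable def projWord {n : ℕ} (w : Fin n → Fin 2) :
    (⨂[k]^n (∀ i, A i)) →ₗ[k] ⨂[k] j : Fin n, A (w j) :=
  PiTensorProduct.map fun j => LinearMap.proj (w j)

/-- The component of a tensor of degree `p + q` at the concatenated word `u v`, read in
`T_u ⊗ T_v = T_{uv}`. -/
noncomputable def comp₀ {p q : ℕ} (u : Fin p → Fin 2) (v : Fin q → Fin 2) :
    (⨂[k]^(p + q) (∀ i, A i)) →ₗ[k]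
      (⨂[k] j : Fin p, A (u j)) ⊗[k] (⨂[k] j : Fin q, A (v j)) :=
  TensorProduct.map (projWord u) (projWord v) ∘ₗ split k (∀ i, A i) p q

/-- The component of a tensor of degree `p + 1 + q` at the word `u i v`, read in
`T_u ⊗ A i ⊗ T_v = T_{uiv}`. -/
noncomputable def comp₁ {p q : ℕ} (u : Fin p → Fin 2) (i : Fin 2) (v : Fin q → Fin 2) :
    (⨂[k]^(p + (1 + q)) (∀ i, A i)) →ₗ[k]
      (⨂[k] j : Fin p, A (u j)) ⊗[k] (A i ⊗[k] (⨂[k] j : Fin q, A (v j))) :=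
  TensorProduct.map (projWord u)
      (TensorProduct.map (LinearMap.proj i) (projWord v) ∘ₗ splitHead k (∀ i, A i) q) ∘ₗ
    split k (∀ i, A i) p (1 + q)

/-- The component of a tensor of degree `p + 2 + q` at the word `u i i v`, read in
`T_u ⊗ (A i ⊗ A i) ⊗ T_v = T_{uiiv}`. -/
noncomputable def comp₂ {p q : ℕ} (u : Fin p → Fin 2) (i : Fin 2) (v : Fin q → Fin 2) :
    (⨂[k]^(p + (1 + (1 + q))) (∀ i, A i)) →ₗ[k]
      (⨂[k] j : Fin p, A (u j)) ⊗[k] ((A i ⊗[k] A i) ⊗[k] (⨂[k] j : Fin q, A (v j))) :=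
  TensorProduct.map (projWord u)
      ((TensorProduct.assoc k (A i) (A i) _).symm.toLinearMap ∘ₗ
        TensorProduct.map (LinearMap.proj i)
          (TensorProduct.map (LinearMap.proj i) (projWord v) ∘ₗ splitHead k (∀ i, A i) q) ∘ₗ
        splitHead k (∀ i, A i) (1 + q)) ∘ₗ
    split k (∀ i, A i) p (1 + (1 + q))

/-- `f` is multiplicatively coherent: comultiplying the letter `i` in the component of `f` at the
word `u i v` gives the component of `f` at `u i i v`. (A word of length `n ≥ 1` with a marked
position is the same thing as a decomposition `u i v`.) -/
def IsMultiplicativelyCoherent (f : CompletedTensor k (∀ i, A i)) : Prop :=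
  ∀ (p q : ℕ) (u : Fin p → Fin 2) (i : Fin 2) (v : Fin q → Fin 2),
    ((Coalgebra.comul (R := k) (A := A i)).rTensor _).lTensor _ (comp₁ u i v (f (p + (1 + q)))) =
      comp₂ u i v (f (p + (1 + (1 + q))))

/-- `f` is unitally coherent: applying the counit to the letter `i` in the component of `f` at the
word `u i v` gives the component of `f` at `u v`. -/
def IsUnitallyCoherent (f : CompletedTensor k (∀ i, A i)) : Prop :=
  ∀ (p q : ℕ) (u : Fin p → Fin 2) (i : Fin 2) (v : Fin q → Fin 2),
    ((TensorProduct.lid k _).toLinearMap ∘ₗ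
        (Coalgebra.counit (R := k) (A := A i)).rTensor _).lTensor _
          (comp₁ u i v (f (p + (1 + q)))) =
      comp₀ u v (f (p + q))

/-- `f` is coherent over `B`: the components of `f` at `u 0 v` and at `u 1 v` agree in
`T_u ⊗ B ⊗ T_v` after `α 0`, respectively `α 1`, is applied to the marked letter. -/
def IsCoherentOver (α : ∀ i, A i →ₐc[k] B) (f : CompletedTensor k (∀ i, A i)) : Prop :=
  ∀ (p q : ℕ) (u : Fin p → Fin 2) (v : Fin q → Fin 2),
    ((α 0 : A 0 →ₗ[k] B).rTensor _).lTensor _ (comp₁ u 0 v (f (p + (1 + q)))) =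
      ((α 1 : A 1 →ₗ[k] B).rTensor _).lTensor _ (comp₁ u 1 v (f (p + (1 + q))))

/-- The set of coherent elements of the cofree coalgebra `C(A 0 ⊕ A 1)`. -/
def coherentElements (α : ∀ i, A i →ₐc[k] B) : Set (CompletedTensor k (∀ i, A i)) :=
  {f | f ∈ cofree k (∀ i, A i) ∧
    IsMultiplicativelyCoherent f ∧ IsUnitallyCoherent f ∧ IsCoherentOver α f}

/-- The map on `(A 0 ⊕ A 1)^{⊗n}` that applies the antipodes in each factor and then reverses the
order of the factors. -/
noncomputable def antipodeRev (k : Type*) [Field k] (A : Fin 2 → Type*) [∀ i, CommRing (A i)]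
    [∀ i, HopfAlgebra k (A i)] (n : ℕ) : (⨂[k]^n (∀ i, A i)) →ₗ[k] (⨂[k]^n (∀ i, A i)) :=
  (PiTensorProduct.reindex k (fun _ : Fin n => ∀ i, A i) Fin.revPerm).toLinearMap ∘ₗ
    PiTensorProduct.map fun _ =>
      LinearMap.pi fun i => HopfAlgebra.antipode k (A := A i) ∘ₗ LinearMap.proj i

end Coherent

end HopfFibre

/-!
The proof works with functionals. Write `V = A 0 ⊕ A 1`. A word `l = λ₁ ⋯ λₙ` in linear functionals
on `V` defines the functional `f ↦ (λ₁ ⊗ ⋯ ⊗ λₙ)(f_n)` on `T̂V` (`wordDual`). These functionals are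
jointly injective (`separating_wordDual`), and since `k` is a field the same holds for their tensor
products (`Separating.pairing`), so every identity in `T̂V`, `T̂V ⊗ T̂V`, … can be tested on words.

Deconcatenation is dual to the product of the free monoid of words: `f` lies in `C(V)` if and only
if `(l, m) ↦ ⟨l m, f⟩` is a matrix coefficient, that is, `⟨l m, f⟩ = ⟨l ⊗ m, t⟩` for a tensor `t`
(`mem_cofree_iff`). The three coherence conditions say that `⟨-, f⟩` is invariant under a two-sided
substitution of subwords (`CoherenceRel`, `mem_coherentElements_iff`); in other words, coherent
elements are functions on a quotient of the free monoid. Hence the space `K` of coherent elements is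
stable under translations by words on both sides. Slicing `t` with functionals amounts to
translating `f`, so `t` lies in `K ⊗ K` (`exists_comul_of_translate`), and the coalgebra axioms are
the monoid axioms of words (`coalgebraOfSeparating`). All structure maps in the coherence conditions
are maps of algebras, so `K` is a subalgebra and a bialgebra.

The antipode is dual to the anti-automorphism of words that composes letters with the antipodes of
`A 0` and `A 1`; it respects `CoherenceRel` because the antipode of a Hopf algebra reverses the
comultiplication and commutes with `α 0` and `α 1`. Its composite with the component
`K → V^{⊗n}` is a convolution inverse of that component: in degree one because the projections
`K → A i` are maps of bialgebras, and in higher degrees by induction, splitting `V^{⊗(n+1)}` as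
`V^{⊗n} ⊗ V` (`toConv_antipode_mul_component`, `toConv_component_mul_antipode`).

A map of algebras `q : D → V` turns a word into the convolution product of the functionals
`λⱼ ∘ q` on `D` (`convWord`), and the iterated comultiplication of `D` realizes these products by a
map of algebras `D → T̂V` (`liftCompleted`). If `q` comes from a commutative square of bialgebra
maps, the convolution products are invariant under `CoherenceRel`, which gives `D → K`. It is unique
because the pullback of word functionals along a coalgebra map is multiplicative, hence determined
by its values on letters.
-/

namespace HopfFibre

/-! ### Jointly injective families and tensor products over a field -/

section Separation

variable {k : Type*} [Field k] {M N P Q : Type*} [AddCommMonoid M] [Module k M] [AddCommMonoid N]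
  [Module k N] [AddCommMonoid P] [Module k P] [AddCommMonoid Q] [Module k Q]

/-- A family of linear maps out of `M` is separating if it is jointly injective. -/
def Separating {ι : Sort*} {P : ι → Type*} [∀ i, AddCommMonoid (P i)] [∀ i, Module k (P i)]
    (φ : ∀ i, M →ₗ[k] P i) : Prop :=
  ∀ ⦃x y⦄, (∀ i, φ i x = φ i y) → x = y

theorem Separating.of_eq_zero {M : Type*} [AddCommGroup M] [Module k M] {ι : Sort*}
    {P : ι → Type*} [∀ i, AddCommMonoid (P i)] [∀ i, Module k (P i)] {φ : ∀ i, M →ₗ[k] P i}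
    (h : ∀ x, (∀ i, φ i x = 0) → x = 0) : Separating φ := by
  refine fun x y hxy => sub_eq_zero.1 (h _ fun i => ?_)
  have h' : φ i (x - y) + φ i y = 0 + φ i y := by rw [← map_add, sub_add_cancel, hxy, zero_add]
  let := Module.addCommMonoidToAddCommGroup k (M := P i)
  exact add_right_cancel h'

theorem Separating.eq_zero {ι : Sort*} {P : ι → Type*} [∀ i, AddCommMonoid (P i)]
    [∀ i, Module k (P i)] {φ : ∀ i, M →ₗ[k] P i} (h : Separating φ) {x : M}
    (hx : ∀ i, φ i x = 0) : x = 0 :=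
  h fun i => by rw [hx, map_zero]

theorem separating_id : Separating fun _ : Unit => (LinearMap.id : M →ₗ[k] M) :=
  fun _ _ h => h ()

theorem separating_dual : Separating fun φ : Module.Dual k M => φ := by
  let := Module.addCommMonoidToAddCommGroup k (M := M)
  exact .of_eq_zero fun x h => (Module.forall_dual_apply_eq_zero_iff k x).1 h

theorem Separating.rTensor {ι : Sort*} {P : ι → Type*} [∀ i, AddCommMonoid (P i)]
    [∀ i, Module k (P i)] {φ : ∀ i, M →ₗ[k] P i} (h : Separating φ) :
    Separating fun i => (φ i).rTensor N := by
  classical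
  intro t t' ht
  let := Module.addCommMonoidToAddCommGroup k (M := N)
  let b := Module.Basis.ofVectorSpace k N
  -- a basis of `N` turns `M ⊗ N` into a direct sum of copies of `M`, naturally in `M`
  have key : ∀ i (t : M ⊗[k] N) j, TensorProduct.equivFinsuppOfBasisRight b ((φ i).rTensor N t) j =
      φ i (TensorProduct.equivFinsuppOfBasisRight b t j) := by
    intro i t j
    induction t with
    | zero => simp
    | tmul x y => simp
    | add x y hx hy => simp only [map_add, Finsupp.add_apply, hx, hy]
  refine (TensorProduct.equivFinsuppOfBasisRight b).injective (Finsupp.ext fun j => ?_)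
  exact h fun i => by rw [← key, ← key, ht i]

theorem Separating.lTensor {ι : Sort*} {P : ι → Type*} [∀ i, AddCommMonoid (P i)]
    [∀ i, Module k (P i)] {φ : ∀ i, M →ₗ[k] P i} (h : Separating φ) :
    Separating fun i => (φ i).lTensor N := by
  intro t t' ht
  refine (TensorProduct.comm k N M).injective (h.rTensor (N := N) fun i => ?_)
  have (t : N ⊗[k] M) : (φ i).rTensor N (TensorProduct.comm k N M t) =
      TensorProduct.comm k N (P i) ((φ i).lTensor N t) :=
    congr($(LinearMap.rTensor_comp_comm (f := φ i)) t)
  rw [this, this, ht i]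

/-- Over a field, tensor products of separating families are separating. -/
theorem Separating.map {ι κ : Sort*} {P : ι → Type*} [∀ i, AddCommMonoid (P i)]
    [∀ i, Module k (P i)] {Q : κ → Type*} [∀ i, AddCommMonoid (Q i)] [∀ i, Module k (Q i)]
    {φ : ∀ i, M →ₗ[k] P i} {ψ : ∀ j, N →ₗ[k] Q j} (hφ : Separating φ) (hψ : Separating ψ) :
    Separating fun ij : ι ×' κ => TensorProduct.map (φ ij.1) (ψ ij.2) := by
  refine fun t t' ht => hψ.lTensor fun j => hφ.rTensor fun i => ?_
  rw [← LinearMap.comp_apply, ← LinearMap.comp_apply, LinearMap.rTensor_comp_lTensor]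
  exact ht ⟨i, j⟩

/-- The functional `φ ⊗ ψ` on `M ⊗ N`. -/
noncomputable def pairing (φ : Module.Dual k M) (ψ : Module.Dual k N) :
    Module.Dual k (M ⊗[k] N) :=
  LinearMap.mul' k k ∘ₗ TensorProduct.map φ ψ

@[simp]
theorem pairing_tmul (φ : Module.Dual k M) (ψ : Module.Dual k N) (x : M) (y : N) :
    pairing φ ψ (x ⊗ₜ y) = φ x * ψ y := rfl

theorem pairing_map (φ : Module.Dual k P) (ψ : Module.Dual k Q) (g : M →ₗ[k] P) (h : N →ₗ[k] Q)
    (t : M ⊗[k] N) : pairing φ ψ (TensorProduct.map g h t) = pairing (φ ∘ₗ g) (ψ ∘ₗ h) t := by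
  simp [pairing, TensorProduct.map_comp]

theorem pairing_lTensor (φ : Module.Dual k M) (ψ : Module.Dual k Q) (h : N →ₗ[k] Q)
    (t : M ⊗[k] N) : pairing φ ψ (h.lTensor M t) = pairing φ (ψ ∘ₗ h) t :=
  pairing_map φ ψ LinearMap.id h t

theorem pairing_rTensor (φ : Module.Dual k P) (ψ : Module.Dual k N) (g : M →ₗ[k] P)
    (t : M ⊗[k] N) : pairing φ ψ (g.rTensor N t) = pairing (φ ∘ₗ g) ψ t :=
  pairing_map φ ψ g LinearMap.id t

theorem pairing_assoc {φ : Module.Dual k M} {ψ : Module.Dual k N} {χ : Module.Dual k P}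
    (t : (M ⊗[k] N) ⊗[k] P) :
    pairing φ (pairing ψ χ) (TensorProduct.assoc k M N P t) = pairing (pairing φ ψ) χ t := by
  refine congr($(show pairing φ (pairing ψ χ) ∘ₗ (TensorProduct.assoc k M N P).toLinearMap =
    pairing (pairing φ ψ) χ from ?_) t)
  ext; simp [mul_assoc]

theorem pairing_comm {φ : Module.Dual k M} {ψ : Module.Dual k N} (t : N ⊗[k] M) :
    pairing φ ψ (TensorProduct.comm k N M t) = pairing ψ φ t := by
  refine congr($(show pairing φ ψ ∘ₗ (TensorProduct.comm k N M).toLinearMap = pairing ψ φ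
    from ?_) t)
  ext; simp [mul_comm]

theorem Separating.pairing {ι κ : Sort*} {φ : ι → Module.Dual k M} {ψ : κ → Module.Dual k N}
    (hφ : Separating φ) (hψ : Separating ψ) :
    Separating fun ij : ι ×' κ => pairing (φ ij.1) (ψ ij.2) := by
  refine fun t t' ht => hφ.map hψ fun ij => (TensorProduct.lid k k).injective ?_
  have : (TensorProduct.lid k k).toLinearMap = LinearMap.mul' k k := by ext; simp
  exact congr($this _).trans ((ht ij).trans congr($this.symm _))

/-- Contraction of the right factor of `M ⊗ N` with a functional. -/
noncomputable def sliceRight (M : Type*) [AddCommMonoid M] [Module k M] (ψ : Module.Dual k N) :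
    M ⊗[k] N →ₗ[k] M :=
  (TensorProduct.rid k M).toLinearMap ∘ₗ ψ.lTensor M

@[simp]
theorem sliceRight_tmul (ψ : Module.Dual k N) (x : M) (y : N) :
    sliceRight M ψ (x ⊗ₜ y) = ψ y • x := by
  simp [sliceRight]

theorem sliceRight_rTensor (g : M →ₗ[k] P) (ψ : Module.Dual k N) (t : M ⊗[k] N) :
    sliceRight P ψ (g.rTensor N t) = g (sliceRight M ψ t) := by
  refine congr($(show sliceRight P ψ ∘ₗ g.rTensor N = g ∘ₗ sliceRight M ψ from ?_) t)
  ext; simp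

theorem dual_sliceRight (φ : Module.Dual k M) (ψ : Module.Dual k N) (t : M ⊗[k] N) :
    φ (sliceRight M ψ t) = pairing φ ψ t := by
  refine congr($(show φ ∘ₗ sliceRight M ψ = pairing φ ψ from ?_) t)
  ext; simp [mul_comm]

/-- A tensor whose right slices, for a separating family of functionals, lie in a subspace `K`
comes from `K ⊗ N`. -/
theorem exists_rTensor_eq {M N : Type*} [AddCommGroup M] [Module k M] [AddCommGroup N] [Module k N]
    {ι : Sort*} {ψ : ι → Module.Dual k N} (hψ : Separating ψ)
    (K : Submodule k M) (t : M ⊗[k] N) (h : ∀ j, sliceRight M (ψ j) t ∈ K) :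
    ∃ s, K.subtype.rTensor N s = t := by
  -- by exactness of `- ⊗ N` it suffices that `t` vanishes in `(M ⧸ K) ⊗ N`
  refine ((rTensor_exact N (LinearMap.exact_subtype_mkQ K) K.mkQ_surjective) t).1 ?_
  refine hψ.lTensor.eq_zero fun j => (TensorProduct.rid k _).map_eq_zero_iff.1 ?_
  change sliceRight (M ⧸ K) (ψ j) (K.mkQ.rTensor N t) = 0
  rw [sliceRight_rTensor]
  exact (Submodule.Quotient.mk_eq_zero K).2 (h j)

/-- A tensor in `M ⊗ M` all of whose slices on either side, for a separating family of functionals,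
lie in a subspace `K` comes from `K ⊗ K`. -/
theorem exists_map_subtype_eq {M : Type*} [AddCommGroup M] [Module k M] {ι : Sort*}
    {ψ : ι → Module.Dual k M} (hψ : Separating ψ)
    (K : Submodule k M) (t : M ⊗[k] M) (hr : ∀ j, sliceRight M (ψ j) t ∈ K)
    (hl : ∀ j, sliceRight M (ψ j) (TensorProduct.comm k M M t) ∈ K) :
    ∃ s, TensorProduct.map K.subtype K.subtype s = t := by
  obtain ⟨s, rfl⟩ := exists_rTensor_eq hψ K t hr
  have hψK : Separating fun j => (ψ j) ∘ₗ K.subtype :=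
    fun x y hx => Subtype.ext (hψ hx)
  -- the remaining slices of `s` are taken with the restrictions of the functionals to `K`
  obtain ⟨s', hs'⟩ := exists_rTensor_eq hψK K (TensorProduct.comm k K M s) fun j => by
    convert hl j using 1
    refine congr($(show sliceRight M (ψ j ∘ₗ K.subtype) ∘ₗ (TensorProduct.comm k K M).toLinearMap =
      sliceRight M (ψ j) ∘ₗ (TensorProduct.comm k M M).toLinearMap ∘ₗ K.subtype.rTensor M
        from ?_) s)
    ext; simp
  refine ⟨TensorProduct.comm k K K s', ?_⟩
  obtain rfl : (TensorProduct.comm k K M).symm (K.subtype.rTensor K s') = s := by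
    rw [hs', LinearEquiv.symm_apply_apply]
  refine congr($(show
    TensorProduct.map K.subtype K.subtype ∘ₗ (TensorProduct.comm k K K).toLinearMap =
    K.subtype.rTensor M ∘ₗ (TensorProduct.comm k K M).symm.toLinearMap ∘ₗ K.subtype.rTensor K
      from ?_) s')
  ext; simp

end Separation

/-! ### Words of functionals on the completed tensor space -/

section Words

variable {k V : Type*} [Field k] [AddCommGroup V] [Module k V]

/-- The functional `a 0 ⊗ ⋯ ⊗ a (n - 1)` on `V^{⊗n}`. -/
noncomputable def tensorDual {n : ℕ} (a : Fin n → Module.Dual k V) : Module.Dual k (⨂[k]^n V) :=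
  PiTensorProduct.lift ((MultilinearMap.mkPiAlgebra k (Fin n) k).compLinearMap a)

@[simp]
theorem tensorDual_tprod {n : ℕ} (a : Fin n → Module.Dual k V) (x : Fin n → V) :
    tensorDual a (PiTensorProduct.tprod k x) = ∏ j, a j (x j) := by
  simp [tensorDual]

theorem split_tprod_append {p q : ℕ} (x : Fin p → V) (y : Fin q → V) :
    split k V p q (PiTensorProduct.tprod k (Fin.append x y)) =
      PiTensorProduct.tprod k x ⊗ₜ PiTensorProduct.tprod k y := by
  rw [← TensorPower.tprod_mul_tprod, TensorPower.gMul_def]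
  exact LinearEquiv.symm_apply_apply _ _

theorem split_tprod (p q : ℕ) (x : Fin (p + q) → V) :
    split k V p q (PiTensorProduct.tprod k x) =
      PiTensorProduct.tprod k (fun j => x (Fin.castAdd q j)) ⊗ₜ
        PiTensorProduct.tprod k (fun j => x (Fin.natAdd p j)) := by
  rw [← split_tprod_append, Fin.append_castAdd_natAdd]

theorem split_injective (p q : ℕ) : Function.Injective (split k V p q) :=
  LinearEquiv.injective _

@[simp]
theorem degreeOne_tprod (x : Fin 1 → V) : degreeOne k V (PiTensorProduct.tprod k x) = x 0 :=
  PiTensorProduct.subsingletonEquiv_apply_tprod _ _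

theorem tensorDual_append {p q : ℕ} (a : Fin p → Module.Dual k V) (b : Fin q → Module.Dual k V) :
    tensorDual (Fin.append a b) = pairing (tensorDual a) (tensorDual b) ∘ₗ split k V p q := by
  ext x
  simp [split_tprod, Fin.prod_univ_add]

theorem tensorDual_one (a : Fin 1 → Module.Dual k V) : tensorDual a = a 0 ∘ₗ degreeOne k V := by
  ext x; simp

theorem tensorDual_head {q : ℕ} (c : Module.Dual k V) (b : Fin q → Module.Dual k V) :
    tensorDual (Fin.append (fun _ : Fin 1 => c) b) =
      pairing c (tensorDual b) ∘ₗ splitHead k V q := by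
  ext x
  rw [tensorDual_append, tensorDual_one]
  simp [splitHead, pairing_rTensor]

/-- Pure functionals separate the points of a tensor power. -/
theorem separating_tensorDual (n : ℕ) :
    Separating fun a : Fin n → Module.Dual k V => tensorDual a := by
  induction n with
  | zero =>
    intro x y hx
    have : (PiTensorProduct.isEmptyEquiv (R := k) (s := fun _ : Fin 0 => V)
        (Fin 0)).toLinearMap = tensorDual Fin.elim0 := by
      ext; simp
    exact (PiTensorProduct.isEmptyEquiv (R := k) (s := fun _ : Fin 0 => V) (Fin 0)).injective
      (congr($this x).trans ((hx _).trans congr($this.symm y)))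
  | succ n ih =>
    intro x y hx
    have h1 : Separating fun c : Module.Dual k V => c ∘ₗ degreeOne k V := fun y z hy =>
      LinearEquiv.injective (PiTensorProduct.subsingletonEquiv 0) (separating_dual hy)
    refine split_injective n 1 (ih.pairing h1 fun ⟨a, c⟩ => ?_)
    have := hx (Fin.append a fun _ => c)
    simp only [tensorDual_append, tensorDual_one] at this
    exact this

variable (k V) in
/-- The functional on `T̂V` attached to a word `λ₁ ⋯ λₙ` in linear functionals on `V`: it sends `f`
to `(λ₁ ⊗ ⋯ ⊗ λₙ)(f_n)`. -/
noncomputable def wordDual (l : FreeMonoid (Module.Dual k V)) :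
    Module.Dual k (CompletedTensor k V) :=
  tensorDual l.toList.get ∘ₗ LinearMap.proj (R := k) (φ := fun n => ⨂[k]^n V) l.toList.length

/-- The word with letters `a 0, …, a (n - 1)`. -/
def word {X : Type*} {n : ℕ} (a : Fin n → X) : FreeMonoid X := FreeMonoid.ofList (List.ofFn a)

theorem exists_word {X : Type*} (l : FreeMonoid X) : ∃ (n : ℕ) (a : Fin n → X), l = word a :=
  ⟨_, l.toList.get, by simp [word]⟩

theorem word_append {X : Type*} {p q : ℕ} (a : Fin p → X) (b : Fin q → X) :
    word (Fin.append a b) = word a * word b := by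
  rw [word, List.ofFn_fin_append]; rfl

theorem word_const {X : Type*} (c : X) : word (fun _ : Fin 1 => c) = FreeMonoid.of c := by
  simp [word]

theorem wordDual_word {n : ℕ} (a : Fin n → Module.Dual k V) (f : CompletedTensor k V) :
    wordDual k V (word a) f = tensorDual a (f n) := by
  -- the word `word a` has length `n` only propositionally
  have aux : ∀ (m : ℕ) (h : m = n) (b : Fin m → Module.Dual k V), b = a ∘ Fin.cast h →
      tensorDual b (f m) = tensorDual a (f n) := by
    rintro m rfl b rfl; rfl
  refine aux _ (by simp [word]) _ ?_
  ext j : 1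
  exact List.get_ofFn _ _

variable (k V) in
theorem separating_wordDual : Separating (wordDual k V) := by
  intro f g hf
  ext n : 1
  exact separating_tensorDual n fun a => by rw [← wordDual_word, hf, wordDual_word]

theorem wordDual_mul {p q : ℕ} (a : Fin p → Module.Dual k V) (b : Fin q → Module.Dual k V)
    (f : CompletedTensor k V) : wordDual k V (word a * word b) f =
      pairing (tensorDual a) (tensorDual b) (split k V p q (f (p + q))) := by
  rw [← word_append, wordDual_word, tensorDual_append]; rfl

theorem wordDual_one (f : CompletedTensor k V) :
    wordDual k V 1 f = PiTensorProduct.isEmptyEquiv (Fin 0) (f 0) := by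
  refine congr($(show tensorDual (k := k) (V := V) _ =
    (PiTensorProduct.isEmptyEquiv (Fin 0)).toLinearMap from ?_) (f 0))
  ext; simp

theorem wordDual_of (c : Module.Dual k V) (f : CompletedTensor k V) :
    wordDual k V (FreeMonoid.of c) f = c (degreeOne k V (f 1)) := by
  rw [← word_const, wordDual_word, tensorDual_one]; rfl

theorem wordDual_mul_of_mul {p q : ℕ} (a : Fin p → Module.Dual k V) (c : Module.Dual k V)
    (b : Fin q → Module.Dual k V) (f : CompletedTensor k V) :
    wordDual k V (word a * FreeMonoid.of c * word b) f =
      pairing (tensorDual a) (pairing c (tensorDual b))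
        ((splitHead k V q).lTensor _ (split k V p (1 + q) (f (p + (1 + q))))) := by
  rw [mul_assoc, ← word_const, ← word_append, wordDual_mul, tensorDual_head, pairing_lTensor]

theorem wordDual_mul_of_of_mul {p q : ℕ} (a : Fin p → Module.Dual k V) (c d : Module.Dual k V)
    (b : Fin q → Module.Dual k V) (f : CompletedTensor k V) :
    wordDual k V (word a * FreeMonoid.of c * FreeMonoid.of d * word b) f =
      pairing (tensorDual a) (pairing c (pairing d (tensorDual b)))
        ((((splitHead k V q).lTensor _ ∘ₗ splitHead k V (1 + q))).lTensor _
          (split k V p (1 + (1 + q)) (f (p + (1 + (1 + q)))))) := by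
  rw [mul_assoc, mul_assoc, ← word_const d, ← word_append, ← word_const c, ← word_append,
    wordDual_mul, tensorDual_head, tensorDual_head, LinearMap.lTensor_comp, LinearMap.comp_apply,
    pairing_lTensor, pairing_lTensor]
  congr 2
  ext x
  simp [pairing_lTensor]

/-- Right translation on `T̂V` by a word. -/
noncomputable def translate {n : ℕ} (a : Fin n → Module.Dual k V) :
    CompletedTensor k V →ₗ[k] CompletedTensor k V :=
  LinearMap.pi fun p => sliceRight _ (tensorDual a) ∘ₗ split k V p n ∘ₗ LinearMap.proj (p + n)

theorem wordDual_translate {n : ℕ} (a : Fin n → Module.Dual k V)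
    (l : FreeMonoid (Module.Dual k V)) (f : CompletedTensor k V) :
    wordDual k V l (translate a f) = wordDual k V (l * word a) f := by
  obtain ⟨m, b, rfl⟩ := exists_word l
  rw [wordDual_word, wordDual_mul]
  exact dual_sliceRight _ _ _

/-- Left translation on `T̂V` by a word. -/
noncomputable def translateLeft {n : ℕ} (a : Fin n → Module.Dual k V) :
    CompletedTensor k V →ₗ[k] CompletedTensor k V :=
  LinearMap.pi fun q => sliceRight _ (tensorDual a) ∘ₗ (TensorProduct.comm k _ _).toLinearMap ∘ₗ
    split k V n q ∘ₗ LinearMap.proj (n + q)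

theorem wordDual_translateLeft {n : ℕ} (a : Fin n → Module.Dual k V)
    (l : FreeMonoid (Module.Dual k V)) (f : CompletedTensor k V) :
    wordDual k V l (translateLeft a f) = wordDual k V (word a * l) f := by
  obtain ⟨m, b, rfl⟩ := exists_word l
  rw [wordDual_word, wordDual_mul, ← pairing_comm]
  exact dual_sliceRight _ _ _

/-- The elements of `C(V)` are those `f` for which `(l, m) ↦ ⟨l m, f⟩` is a matrix coefficient of
the free monoid of words. -/
theorem mem_cofree_iff (f : CompletedTensor k V) :
    f ∈ cofree k V ↔ ∃ t : CompletedTensor k V ⊗[k] CompletedTensor k V,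
      ∀ l m, pairing (wordDual k V l) (wordDual k V m) t = wordDual k V (l * m) f := by
  have key : ∀ (t : CompletedTensor k V ⊗[k] CompletedTensor k V) {p q : ℕ}
      (a : Fin p → Module.Dual k V) (b : Fin q → Module.Dual k V),
      pairing (tensorDual a) (tensorDual b)
        (TensorProduct.map (LinearMap.proj (R := k) (φ := fun n => ⨂[k]^n V) p)
          (LinearMap.proj (R := k) (φ := fun n => ⨂[k]^n V) q) t) =
      pairing (wordDual k V (word a)) (wordDual k V (word b)) t := by
    intro t p q a b
    rw [pairing_map]
    congr 2 <;> ext1 x <;> exact (wordDual_word _ _).symm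
  refine exists_congr fun t => ⟨fun h l m => ?_, fun h p q => ?_⟩
  · obtain ⟨p, a, rfl⟩ := exists_word l
    obtain ⟨q, b, rfl⟩ := exists_word m
    rw [← key, h, wordDual_mul]
  · refine ((separating_tensorDual p).pairing (separating_tensorDual q)) fun ⟨a, b⟩ => ?_
    rw [← wordDual_mul, ← h, ← key]

/-- A subspace of `C(V)` that is stable under translation by words on either side is a
subcoalgebra. -/
theorem exists_comul_of_translate (K : Submodule k (CompletedTensor k V))
    (hK : ∀ f ∈ K, f ∈ cofree k V)
    (hr : ∀ f ∈ K, ∀ g m, (∀ l, wordDual k V l g = wordDual k V (l * m) f) → g ∈ K)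
    (hl : ∀ f ∈ K, ∀ g m, (∀ l, wordDual k V l g = wordDual k V (m * l) f) → g ∈ K) (f : K) :
    ∃ t : K ⊗[k] K, ∀ l m, pairing (wordDual k V l ∘ₗ K.subtype) (wordDual k V m ∘ₗ K.subtype) t =
      wordDual k V (l * m) f := by
  obtain ⟨t, ht⟩ := (mem_cofree_iff _).1 (hK f f.2)
  obtain ⟨s, rfl⟩ := exists_map_subtype_eq (separating_wordDual k V) K t
    (fun m => hr f f.2 _ m fun l => by rw [dual_sliceRight, ht])
    (fun m => hl f f.2 _ m fun l => by rw [dual_sliceRight, pairing_comm, ht])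
  exact ⟨s, fun l m => by rw [← ht, pairing_map]⟩

/-- `C(V)` is stable under right translation by words. -/
theorem mem_cofree_of_translate_right {f g : CompletedTensor k V} (hf : f ∈ cofree k V)
    (m : FreeMonoid (Module.Dual k V)) (h : ∀ l, wordDual k V l g = wordDual k V (l * m) f) :
    g ∈ cofree k V := by
  obtain ⟨t, ht⟩ := (mem_cofree_iff _).1 hf
  obtain ⟨n, a, rfl⟩ := exists_word m
  refine (mem_cofree_iff _).2 ⟨(translate a).lTensor _ t, fun l l' => ?_⟩
  rw [pairing_lTensor, h, mul_assoc, ← ht]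
  congr 2
  ext1 x
  exact wordDual_translate _ _ _

/-- `C(V)` is stable under left translation by words. -/
theorem mem_cofree_of_translate_left {f g : CompletedTensor k V} (hf : f ∈ cofree k V)
    (m : FreeMonoid (Module.Dual k V)) (h : ∀ l, wordDual k V l g = wordDual k V (m * l) f) :
    g ∈ cofree k V := by
  obtain ⟨t, ht⟩ := (mem_cofree_iff _).1 hf
  obtain ⟨n, a, rfl⟩ := exists_word m
  refine (mem_cofree_iff _).2 ⟨(translateLeft a).rTensor _ t, fun l l' => ?_⟩
  rw [pairing_rTensor, h, ← mul_assoc, ← ht]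
  congr 2
  ext1 x
  exact wordDual_translateLeft _ _ _

end Words

/-! ### Coherence in terms of word functionals -/

section Coherence

variable {k : Type*} [Field k] {A : Fin 2 → Type*} [∀ i, CommRing (A i)] [∀ i, HopfAlgebra k (A i)]
  {B : Type*} [CommRing B] [HopfAlgebra k B]

/-- The components at words of length `n` determine a tensor of degree `n`. -/
theorem separating_projWord (n : ℕ) :
    Separating fun w : Fin n → Fin 2 => projWord (k := k) (A := A) w := by
  refine .of_eq_zero fun x hx => ?_
  -- a tensor is the sum of its components, included back along the summands
  have h : (LinearMap.id : (⨂[k]^n (∀ i, A i)) →ₗ[k] _) =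
      ∑ w : Fin n → Fin 2, (PiTensorProduct.map fun j => LinearMap.single k A (w j)) ∘ₗ
        projWord w := by
    refine PiTensorProduct.ext (MultilinearMap.ext fun y => ?_)
    simp only [LinearMap.compMultilinearMap_apply, LinearMap.id_apply, LinearMap.sum_apply,
      LinearMap.comp_apply, projWord, PiTensorProduct.map_tprod, LinearMap.proj_apply]
    rw [← MultilinearMap.map_sum (PiTensorProduct.tprod k)
      (fun j (i : Fin 2) => LinearMap.single k A i (y j i))]
    congr 1
    ext j : 1
    exact (LinearMap.sum_single_apply A (y j)).symm
  rw [← LinearMap.id_apply (R := k) x, h]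
  simpa using Finset.sum_eq_zero fun w _ => by rw [hx w, map_zero]

/-- Equality in `V^{⊗p} ⊗ X ⊗ V^{⊗q}` can be tested on the components at all pairs of words, and
equally on functionals. -/
theorem map_projWord_eq_iff {p q : ℕ} {X ι : Type*} [AddCommGroup X] [Module k X]
    {θ : ι → Module.Dual k X} (hθ : Separating θ)
    (Y Z : (⨂[k]^p (∀ i, A i)) ⊗[k] (X ⊗[k] (⨂[k]^q (∀ i, A i)))) :
    (∀ (u : Fin p → Fin 2) (v : Fin q → Fin 2),
      TensorProduct.map (projWord u) ((projWord v).lTensor X) Y =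
        TensorProduct.map (projWord u) ((projWord v).lTensor X) Z) ↔
    ∀ (a : Fin p → Module.Dual k (∀ i, A i)) (j : ι) (b : Fin q → Module.Dual k (∀ i, A i)),
      pairing (tensorDual a) (pairing (θ j) (tensorDual b)) Y =
        pairing (tensorDual a) (pairing (θ j) (tensorDual b)) Z := by
  trans Y = Z
  · exact ⟨fun h => ((separating_projWord p).map (separating_projWord q).lTensor)
      fun ⟨u, v⟩ => h u v, fun h _ _ => by rw [h]⟩
  · exact ⟨fun h _ _ _ => by rw [h], fun h => ((separating_tensorDual p).pairing
      (hθ.pairing (separating_tensorDual q))) fun ⟨a, j, b⟩ => h a j b⟩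

theorem isMultiplicativelyCoherent_iff (f : CompletedTensor k (∀ i, A i)) :
    IsMultiplicativelyCoherent f ↔
    ∀ (l m : FreeMonoid (Module.Dual k (∀ i, A i))) (i : Fin 2) (c d : Module.Dual k (A i)),
      wordDual k _
        (l * FreeMonoid.of ((pairing c d ∘ₗ Coalgebra.comul) ∘ₗ LinearMap.proj i) * m) f =
      wordDual k _ (l * FreeMonoid.of (c ∘ₗ LinearMap.proj i) *
        FreeMonoid.of (d ∘ₗ LinearMap.proj i) * m) f := by
  have key (p q : ℕ) (i : Fin 2) :
      (∀ (u : Fin p → Fin 2) (v : Fin q → Fin 2),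
        ((Coalgebra.comul (R := k) (A := A i)).rTensor _).lTensor _
            (comp₁ u i v (f (p + (1 + q)))) =
          comp₂ u i v (f (p + (1 + (1 + q))))) ↔
      ∀ (a : Fin p → Module.Dual k (∀ i, A i)) (cd : Module.Dual k (A i) ×' Module.Dual k (A i))
        (b : Fin q → Module.Dual k (∀ i, A i)),
        wordDual k _ (word a * FreeMonoid.of
          ((pairing cd.1 cd.2 ∘ₗ Coalgebra.comul) ∘ₗ LinearMap.proj i) * word b) f =
        wordDual k _ (word a * FreeMonoid.of (cd.1 ∘ₗ LinearMap.proj i) *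
          FreeMonoid.of (cd.2 ∘ₗ LinearMap.proj i) * word b) f := by
    have := map_projWord_eq_iff (k := k) (A := A) (p := p) (q := q)
      ((separating_dual (k := k) (M := A i)).pairing separating_dual)
      (((Coalgebra.comul ∘ₗ LinearMap.proj i).rTensor _ ∘ₗ splitHead k _ q).lTensor _
        (split k _ p (1 + q) (f (p + (1 + q)))))
      (((TensorProduct.assoc k (A i) (A i) _).symm.toLinearMap ∘ₗ
        TensorProduct.map (LinearMap.proj i) ((LinearMap.proj i).rTensor _ ∘ₗ splitHead k _ q) ∘ₗ
          splitHead k (∀ i, A i) (1 + q)).lTensor _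
        (split k _ p (1 + (1 + q)) (f (p + (1 + (1 + q))))))
    refine (Iff.trans ?_ this).trans ?_
    · refine forall₂_congr fun u v => Eq.congr ?_ ?_
      · simp only [comp₁, LinearMap.lTensor, LinearMap.rTensor, ← LinearMap.comp_apply,
          ← TensorProduct.map_comp, LinearMap.comp_id, LinearMap.id_comp, ← LinearMap.comp_assoc]
      · simp only [comp₂, LinearMap.lTensor, LinearMap.rTensor, ← LinearMap.comp_apply,
          ← TensorProduct.map_comp, LinearMap.comp_id, ← LinearMap.comp_assoc]
        rw [← TensorProduct.map_id, TensorProduct.map_map_comp_assoc_symm_eq]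
        simp only [← TensorProduct.map_comp, LinearMap.id_comp,
          LinearMap.comp_assoc]
        simp only [← LinearMap.comp_assoc, ← TensorProduct.map_comp, LinearMap.id_comp,
          LinearMap.comp_id]
    · refine forall₃_congr fun a cd b => Eq.congr ?_ ?_
      · rw [wordDual_mul_of_mul, pairing_lTensor, pairing_lTensor]
        congr 2
        refine LinearMap.ext fun x => ?_
        simp only [LinearMap.comp_apply, pairing_rTensor, LinearMap.comp_assoc]
      · rw [wordDual_mul_of_of_mul, pairing_lTensor, pairing_lTensor]
        congr 2
        refine LinearMap.ext fun x => ?_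
        simp only [LinearMap.comp_apply, ← pairing_assoc, LinearEquiv.coe_coe,
          LinearEquiv.apply_symm_apply, pairing_map, pairing_lTensor]
        congr 2
        refine LinearMap.ext fun x => ?_
        simp only [LinearMap.comp_apply, pairing_rTensor]
  refine ⟨fun h l m i c d => ?_, fun h p q u i v => (key p q i).2 (fun a cd b => h _ _ _ _ _) u v⟩
  obtain ⟨p, a, rfl⟩ := exists_word l
  obtain ⟨q, b, rfl⟩ := exists_word m
  exact (key p q i).1 (fun u v => h p q u i v) a ⟨c, d⟩ b

theorem isUnitallyCoherent_iff (f : CompletedTensor k (∀ i, A i)) :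
    IsUnitallyCoherent f ↔
    ∀ (l m : FreeMonoid (Module.Dual k (∀ i, A i))) (i : Fin 2),
      wordDual k _ (l * FreeMonoid.of (Coalgebra.counit (A := A i) ∘ₗ LinearMap.proj i) * m) f =
      wordDual k _ (l * m) f := by
  have key (p q : ℕ) (i : Fin 2) :
      (∀ (u : Fin p → Fin 2) (v : Fin q → Fin 2),
        ((TensorProduct.lid k _).toLinearMap ∘ₗ
          (Coalgebra.counit (R := k) (A := A i)).rTensor _).lTensor _
            (comp₁ u i v (f (p + (1 + q)))) = comp₀ u v (f (p + q))) ↔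
      ∀ (a : Fin p → Module.Dual k (∀ i, A i)) (b : Fin q → Module.Dual k (∀ i, A i)),
        wordDual k _ (word a * FreeMonoid.of
          (Coalgebra.counit (A := A i) ∘ₗ LinearMap.proj i) * word b) f =
        wordDual k _ (word a * word b) f := by
    trans ((TensorProduct.lid k _).toLinearMap ∘ₗ
      (Coalgebra.counit (A := A i) ∘ₗ LinearMap.proj i).rTensor _ ∘ₗ splitHead k _ q).lTensor _
        (split k _ p (1 + q) (f (p + (1 + q)))) = split k _ p q (f (p + q))
    · trans ∀ (u : Fin p → Fin 2) (v : Fin q → Fin 2),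
        TensorProduct.map (projWord u) (projWord v) (((TensorProduct.lid k _).toLinearMap ∘ₗ
          (Coalgebra.counit (A := A i) ∘ₗ LinearMap.proj i).rTensor _ ∘ₗ splitHead k _ q).lTensor _
            (split k _ p (1 + q) (f (p + (1 + q))))) =
        TensorProduct.map (projWord u) (projWord v) (split k _ p q (f (p + q)))
      · refine forall₂_congr fun u v => Eq.congr ?_ rfl
        simp only [comp₁, LinearMap.lTensor, ← LinearMap.comp_apply, ← TensorProduct.map_comp,
          LinearMap.comp_id, LinearMap.id_comp, ← LinearMap.comp_assoc]
        congr 3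
        refine congrArg (· ∘ₗ _) ?_
        ext x y
        simp
      · exact ⟨fun h => ((separating_projWord p).map (separating_projWord q))
          fun ⟨u, v⟩ => h u v, fun h _ _ => by rw [h]⟩
    · trans ∀ (a : Fin p → Module.Dual k (∀ i, A i)) (b : Fin q → Module.Dual k (∀ i, A i)),
        pairing (tensorDual a) (tensorDual b) (((TensorProduct.lid k _).toLinearMap ∘ₗ
          (Coalgebra.counit (A := A i) ∘ₗ LinearMap.proj i).rTensor _ ∘ₗ splitHead k _ q).lTensor _
            (split k _ p (1 + q) (f (p + (1 + q))))) =
        pairing (tensorDual a) (tensorDual b) (split k _ p q (f (p + q)))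
      · exact ⟨fun h _ _ => by rw [h], fun h => ((separating_tensorDual p).pairing
          (separating_tensorDual q)) fun ⟨a, b⟩ => h a b⟩
      · refine forall₂_congr fun a b => Eq.congr ?_ (wordDual_mul _ _ _).symm
        rw [wordDual_mul_of_mul, pairing_lTensor, pairing_lTensor]
        congr 2
        rw [← LinearMap.comp_assoc, ← LinearMap.comp_assoc]
        refine congrArg (· ∘ₗ _) ?_
        ext x y
        simp
  refine ⟨fun h l m i => ?_, fun h p q u i v => (key p q i).2 (fun a b => h _ _ _) u v⟩
  obtain ⟨p, a, rfl⟩ := exists_word l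
  obtain ⟨q, b, rfl⟩ := exists_word m
  exact (key p q i).1 (fun u v => h p q u i v) a b

theorem isCoherentOver_iff (α : ∀ i, A i →ₐc[k] B) (f : CompletedTensor k (∀ i, A i)) :
    IsCoherentOver α f ↔
    ∀ (l m : FreeMonoid (Module.Dual k (∀ i, A i))) (c : Module.Dual k B),
      wordDual k _ (l * FreeMonoid.of ((c ∘ₗ (α 0 : A 0 →ₗ[k] B)) ∘ₗ LinearMap.proj 0) * m) f =
      wordDual k _ (l * FreeMonoid.of ((c ∘ₗ (α 1 : A 1 →ₗ[k] B)) ∘ₗ LinearMap.proj 1) * m) f := by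
  have key (p q : ℕ) :
      (∀ (u : Fin p → Fin 2) (v : Fin q → Fin 2),
        ((α 0 : A 0 →ₗ[k] B).rTensor _).lTensor _ (comp₁ u 0 v (f (p + (1 + q)))) =
          ((α 1 : A 1 →ₗ[k] B).rTensor _).lTensor _ (comp₁ u 1 v (f (p + (1 + q))))) ↔
      ∀ (a : Fin p → Module.Dual k (∀ i, A i)) (c : Module.Dual k B)
        (b : Fin q → Module.Dual k (∀ i, A i)),
        wordDual k _ (word a * FreeMonoid.of ((c ∘ₗ (α 0 : A 0 →ₗ[k] B)) ∘ₗ LinearMap.proj 0) *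
          word b) f =
        wordDual k _ (word a * FreeMonoid.of ((c ∘ₗ (α 1 : A 1 →ₗ[k] B)) ∘ₗ LinearMap.proj 1) *
          word b) f := by
    have := map_projWord_eq_iff (k := k) (A := A) (p := p) (q := q)
      (separating_dual (k := k) (M := B))
      ((((α 0 : A 0 →ₗ[k] B) ∘ₗ LinearMap.proj 0).rTensor _ ∘ₗ splitHead k _ q).lTensor _
        (split k _ p (1 + q) (f (p + (1 + q)))))
      ((((α 1 : A 1 →ₗ[k] B) ∘ₗ LinearMap.proj 1).rTensor _ ∘ₗ splitHead k _ q).lTensor _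
        (split k _ p (1 + q) (f (p + (1 + q)))))
    refine (Iff.trans ?_ this).trans ?_
    · refine forall₂_congr fun u v => Eq.congr ?_ ?_ <;>
      simp only [comp₁, LinearMap.lTensor, LinearMap.rTensor, ← LinearMap.comp_apply,
        ← TensorProduct.map_comp, LinearMap.comp_id, LinearMap.id_comp, ← LinearMap.comp_assoc]
    · refine forall₃_congr fun a c b => Eq.congr ?_ ?_ <;>
      · rw [wordDual_mul_of_mul, pairing_lTensor, pairing_lTensor]
        congr 2
        refine LinearMap.ext fun x => ?_
        simp only [LinearMap.comp_apply, pairing_rTensor, LinearMap.comp_assoc]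
  refine ⟨fun h l m c => ?_, fun h p q u v => (key p q).2 (fun a c b => h _ _ _) u v⟩
  obtain ⟨p, a, rfl⟩ := exists_word l
  obtain ⟨q, b, rfl⟩ := exists_word m
  exact (key p q).1 (fun u v => h p q u v) a c b

end Coherence

/-! ### The subalgebra of coherent elements -/

section AlgebraMaps

variable {k : Type*} [Field k]

/-- A linear map between algebras that respects `1` and products. A predicate rather than a bundled
`AlgHom`, since the maps in the coherence conditions are composites of linear maps. -/
structure IsAlgebraMap {R S : Type*} [Semiring R] [Algebra k R] [Semiring S] [Algebra k S]
    (φ : R →ₗ[k] S) : Prop where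
  map_one : φ 1 = 1
  map_mul : ∀ x y, φ (x * y) = φ x * φ y

namespace IsAlgebraMap

variable {R S T U : Type*} [Semiring R] [Algebra k R] [Semiring S] [Algebra k S] [Semiring T]
  [Algebra k T] [Semiring U] [Algebra k U]

theorem of_algHom (φ : R →ₐ[k] S) : IsAlgebraMap φ.toLinearMap :=
  ⟨_root_.map_one φ, _root_.map_mul φ⟩

theorem id : IsAlgebraMap (LinearMap.id : R →ₗ[k] R) := ⟨rfl, fun _ _ => rfl⟩

theorem comp {φ : S →ₗ[k] T} {ψ : R →ₗ[k] S} (hφ : IsAlgebraMap φ) (hψ : IsAlgebraMap ψ) :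
    IsAlgebraMap (φ ∘ₗ ψ) :=
  ⟨by simp [hψ.map_one, hφ.map_one], fun x y => by simp [hψ.map_mul, hφ.map_mul]⟩

theorem tensorMap {φ : R →ₗ[k] S} {ψ : T →ₗ[k] U} (hφ : IsAlgebraMap φ) (hψ : IsAlgebraMap ψ) :
    IsAlgebraMap (TensorProduct.map φ ψ) :=
  of_algHom (Algebra.TensorProduct.map (AlgHom.ofLinearMap φ hφ.map_one hφ.map_mul)
    (AlgHom.ofLinearMap ψ hψ.map_one hψ.map_mul))

theorem lTensor {φ : R →ₗ[k] S} (hφ : IsAlgebraMap φ) : IsAlgebraMap (φ.lTensor T) :=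
  id.tensorMap hφ

theorem rTensor {φ : R →ₗ[k] S} (hφ : IsAlgebraMap φ) : IsAlgebraMap (φ.rTensor T) :=
  hφ.tensorMap id

theorem of_tprod {ι : Type*} {R : ι → Type*} [∀ j, Semiring (R j)] [∀ j, Algebra k (R j)]
    {φ : (⨂[k] j, R j) →ₗ[k] S} (h1 : φ (PiTensorProduct.tprod k 1) = 1)
    (hmul : ∀ x y, φ (PiTensorProduct.tprod k (x * y)) =
      φ (PiTensorProduct.tprod k x) * φ (PiTensorProduct.tprod k y)) : IsAlgebraMap φ := by
  refine ⟨h1, (LinearMap.map_mul_iff _).2 ?_⟩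
  ext x y
  simpa [PiTensorProduct.tprod_mul_tprod] using hmul x y

theorem assoc_comp_map_comp {E E₀ E₁ E₂ E₃ P Q V C : Type*} [Semiring E] [Algebra k E]
    [Semiring E₀] [Algebra k E₀] [Semiring E₁] [Algebra k E₁] [Semiring E₂] [Algebra k E₂]
    [Semiring E₃] [Algebra k E₃] [Semiring P] [Algebra k P] [Semiring Q] [Algebra k Q]
    [Semiring V] [Algebra k V] [Semiring C] [Algebra k C]
    {s : E →ₗ[k] E₀ ⊗[k] E₁} (hs : IsAlgebraMap s) {φ : E₀ →ₗ[k] P} (hφ : IsAlgebraMap φ)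
    {h : E₁ →ₗ[k] V ⊗[k] E₂} (hh : IsAlgebraMap h) {h' : E₂ →ₗ[k] V ⊗[k] E₃}
    (hh' : IsAlgebraMap h') {π : V →ₗ[k] C} (hπ : IsAlgebraMap π) {ψ : E₃ →ₗ[k] Q}
    (hψ : IsAlgebraMap ψ) :
    IsAlgebraMap (k := k) (R := E) (S := P ⊗[k] ((C ⊗[k] C) ⊗[k] Q))
      (TensorProduct.map φ ((TensorProduct.assoc k C C Q).symm.toLinearMap ∘ₗ
      TensorProduct.map π (TensorProduct.map π ψ ∘ₗ h') ∘ₗ h) ∘ₗ s) := by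
  have h1 : IsAlgebraMap (TensorProduct.assoc k C C Q).symm.toLinearMap :=
    .of_algHom (Algebra.TensorProduct.assoc k k k C C Q).symm.toAlgHom
  have h2 := hπ.tensorMap ((hπ.tensorMap hψ).comp hh')
  exact (hφ.tensorMap (h1.comp (h2.comp hh))).comp hs

theorem lTensor_comp_map_comp {E E₀ E₁ E₃ P Q V C X : Type*} [Semiring E] [Algebra k E]
    [Semiring E₀] [Algebra k E₀] [Semiring E₁] [Algebra k E₁]
    [Semiring E₃] [Algebra k E₃] [Semiring P] [Algebra k P] [Semiring Q] [Algebra k Q]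
    [Semiring V] [Algebra k V] [Semiring C] [Algebra k C] [Semiring X] [Algebra k X]
    {s : E →ₗ[k] E₀ ⊗[k] E₁} (hs : IsAlgebraMap s) {φ : E₀ →ₗ[k] P} (hφ : IsAlgebraMap φ)
    {h : E₁ →ₗ[k] V ⊗[k] E₃} (hh : IsAlgebraMap h) {π : V →ₗ[k] C} (hπ : IsAlgebraMap π)
    {ψ : E₃ →ₗ[k] Q} (hψ : IsAlgebraMap ψ) {χ : C ⊗[k] Q →ₗ[k] X} (hχ : IsAlgebraMap χ) :
    IsAlgebraMap (χ.lTensor P ∘ₗ TensorProduct.map φ (TensorProduct.map π ψ ∘ₗ h) ∘ₗ s) :=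
  hχ.lTensor.comp ((hφ.tensorMap ((hπ.tensorMap hψ).comp hh)).comp hs)

end IsAlgebraMap

section TensorPower

variable (k : Type*) [Field k] (V : Type*) [CommRing V] [Algebra k V]

theorem isAlgebraMap_split (p q : ℕ) : IsAlgebraMap (split k V p q) := by
  refine ⟨split_tprod p q 1, (LinearMap.map_mul_iff _).2 ?_⟩
  ext x y
  simp [split_tprod, PiTensorProduct.tprod_mul_tprod]
  rfl

theorem isAlgebraMap_degreeOne : IsAlgebraMap (degreeOne k V) := by
  refine ⟨degreeOne_tprod 1, (LinearMap.map_mul_iff _).2 ?_⟩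
  ext x y
  simp [PiTensorProduct.tprod_mul_tprod]

theorem isAlgebraMap_splitHead (q : ℕ) : IsAlgebraMap (splitHead k V q) :=
  (isAlgebraMap_degreeOne k V).rTensor.comp (isAlgebraMap_split k V 1 q)

end TensorPower

section Components

variable {A : Fin 2 → Type*} [∀ i, CommRing (A i)] [∀ i, HopfAlgebra k (A i)]
  {B : Type*} [CommRing B] [HopfAlgebra k B]

theorem isAlgebraMap_proj (i : Fin 2) : IsAlgebraMap (LinearMap.proj i : (∀ i, A i) →ₗ[k] A i) :=
  ⟨rfl, fun _ _ => rfl⟩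

theorem isAlgebraMap_projWord {n : ℕ} (w : Fin n → Fin 2) :
    IsAlgebraMap (projWord (k := k) (A := A) w) := by
  refine IsAlgebraMap.of_tprod (PiTensorProduct.map_tprod _ _) fun x y => ?_
  simp only [projWord, PiTensorProduct.map_tprod, PiTensorProduct.tprod_mul_tprod]
  rfl

theorem isAlgebraMap_comp₀ {p q : ℕ} (u : Fin p → Fin 2) (v : Fin q → Fin 2) :
    IsAlgebraMap (comp₀ (k := k) (A := A) u v) :=
  ((isAlgebraMap_projWord u).tensorMap (isAlgebraMap_projWord v)).comp (isAlgebraMap_split k _ p q)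

theorem isAlgebraMap_comp₁ {p q : ℕ} (u : Fin p → Fin 2) (i : Fin 2) (v : Fin q → Fin 2)
    {X : Type*} [CommRing X] [Algebra k X] {χ : A i ⊗[k] (⨂[k] j, A (v j)) →ₗ[k] X}
    (hχ : IsAlgebraMap χ) :
    IsAlgebraMap (k := k) (R := ⨂[k]^(p + (1 + q)) (∀ i, A i))
      (S := (⨂[k] j, A (u j)) ⊗[k] X) (χ.lTensor _ ∘ₗ comp₁ (k := k) (A := A) u i v) :=
  IsAlgebraMap.lTensor_comp_map_comp (isAlgebraMap_split k _ p (1 + q)) (isAlgebraMap_projWord u)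
    (isAlgebraMap_splitHead k _ q) (isAlgebraMap_proj i) (isAlgebraMap_projWord v) hχ

theorem isAlgebraMap_comp₂ {p q : ℕ} (u : Fin p → Fin 2) (i : Fin 2) (v : Fin q → Fin 2) :
    IsAlgebraMap (k := k) (R := ⨂[k]^(p + (1 + (1 + q))) (∀ i, A i))
      (S := (⨂[k] j, A (u j)) ⊗[k] ((A i ⊗[k] A i) ⊗[k] (⨂[k] j, A (v j))))
      (comp₂ (k := k) (A := A) u i v) :=
  IsAlgebraMap.assoc_comp_map_comp (isAlgebraMap_split k _ p (1 + (1 + q)))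
    (isAlgebraMap_projWord u) (isAlgebraMap_splitHead k _ (1 + q)) (isAlgebraMap_splitHead k _ q)
    (isAlgebraMap_proj i) (isAlgebraMap_projWord v)

theorem isAlgebraMap_comul (i : Fin 2) :
    IsAlgebraMap (Coalgebra.comul (R := k) (A := A i)) :=
  IsAlgebraMap.of_algHom (Bialgebra.comulAlgHom k (A i))

theorem isAlgebraMap_counit (i : Fin 2) :
    IsAlgebraMap (Coalgebra.counit (R := k) (A := A i)) :=
  IsAlgebraMap.of_algHom (Bialgebra.counitAlgHom k (A i))

theorem IsAlgebraMap.lid (R : Type*) [Semiring R] [Algebra k R] :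
    IsAlgebraMap (TensorProduct.lid k R).toLinearMap :=
  IsAlgebraMap.of_algHom (Algebra.TensorProduct.lid k R).toAlgHom

theorem isAlgebraMap_map_proj {E : ℕ → Type*} [∀ n, Semiring (E n)] [∀ n, Algebra k (E n)]
    (p q : ℕ) : IsAlgebraMap (TensorProduct.map (LinearMap.proj (R := k) (φ := E) p)
      (LinearMap.proj (R := k) (φ := E) q)) :=
  IsAlgebraMap.tensorMap ⟨rfl, fun _ _ => rfl⟩ ⟨rfl, fun _ _ => rfl⟩

theorem mul_mem_cofree {V : Type*} [CommRing V] [Algebra k V] {f g : CompletedTensor k V}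
    (hf : f ∈ cofree k V) (hg : g ∈ cofree k V) : f * g ∈ cofree k V := by
  obtain ⟨s, hs⟩ := hf
  obtain ⟨t, ht⟩ := hg
  refine ⟨s * t, fun p q => ?_⟩
  rw [Pi.mul_apply, (isAlgebraMap_split k _ p q).map_mul, ← hs, ← ht]
  exact (isAlgebraMap_map_proj p q).map_mul s t

theorem IsAlgebraMap.eq_one {R R' S : Type*} [Semiring R] [Algebra k R] [Semiring R']
    [Algebra k R'] [Semiring S] [Algebra k S] {φ : R →ₗ[k] S} {ψ : R' →ₗ[k] S}
    (hφ : IsAlgebraMap φ) (hψ : IsAlgebraMap ψ) : φ 1 = ψ 1 :=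
  hφ.map_one.trans hψ.map_one.symm

theorem IsAlgebraMap.eq_mul {R R' S : Type*} [Semiring R] [Algebra k R] [Semiring R']
    [Algebra k R'] [Semiring S] [Algebra k S] {φ : R →ₗ[k] S} {ψ : R' →ₗ[k] S}
    (hφ : IsAlgebraMap φ) (hψ : IsAlgebraMap ψ) {x y : R} {x' y' : R'} (hx : φ x = ψ x')
    (hy : φ y = ψ y') : φ (x * y) = ψ (x' * y') := by
  rw [hφ.map_mul, hψ.map_mul, hx, hy]

theorem isAlgebraMap_comul_comp₁ {p q : ℕ} (u : Fin p → Fin 2) (i : Fin 2) (v : Fin q → Fin 2) :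
    IsAlgebraMap (k := k) (R := ⨂[k]^(p + (1 + q)) (∀ i, A i))
      (S := (⨂[k] j, A (u j)) ⊗[k] ((A i ⊗[k] A i) ⊗[k] (⨂[k] j, A (v j))))
      (((Coalgebra.comul (R := k) (A := A i)).rTensor _).lTensor _ ∘ₗ comp₁ u i v) :=
  isAlgebraMap_comp₁ u i v (isAlgebraMap_comul i).rTensor

theorem isAlgebraMap_counit_comp₁ {p q : ℕ} (u : Fin p → Fin 2) (i : Fin 2) (v : Fin q → Fin 2) :
    IsAlgebraMap (k := k) (R := ⨂[k]^(p + (1 + q)) (∀ i, A i))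
      (S := (⨂[k] j, A (u j)) ⊗[k] (⨂[k] j, A (v j)))
      (((TensorProduct.lid k _).toLinearMap ∘ₗ
        (Coalgebra.counit (R := k) (A := A i)).rTensor _).lTensor _ ∘ₗ comp₁ u i v) :=
  isAlgebraMap_comp₁ u i v ((IsAlgebraMap.lid _).comp (isAlgebraMap_counit i).rTensor)

theorem isAlgebraMap_bialgHom_comp₁ {p q : ℕ} (u : Fin p → Fin 2) (i : Fin 2) (v : Fin q → Fin 2)
    (β : A i →ₐc[k] B) :
    IsAlgebraMap (k := k) (R := ⨂[k]^(p + (1 + q)) (∀ i, A i))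
      (S := (⨂[k] j, A (u j)) ⊗[k] (B ⊗[k] (⨂[k] j, A (v j))))
      (((β : A i →ₗ[k] B).rTensor _).lTensor _ ∘ₗ comp₁ u i v) :=
  isAlgebraMap_comp₁ u i v (IsAlgebraMap.of_algHom (β : A i →ₐ[k] B)).rTensor

theorem one_mem_coherentElements (α : ∀ i, A i →ₐc[k] B) : 1 ∈ coherentElements α :=
  ⟨⟨1, fun p q => (isAlgebraMap_split k _ p q).map_one.symm⟩,
    fun _ _ u i v => (isAlgebraMap_comul_comp₁ u i v).eq_one (isAlgebraMap_comp₂ u i v),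
    fun _ _ u i v => (isAlgebraMap_counit_comp₁ u i v).eq_one (isAlgebraMap_comp₀ u v),
    fun _ _ u v => (isAlgebraMap_bialgHom_comp₁ u 0 v (α 0)).eq_one
      (isAlgebraMap_bialgHom_comp₁ u 1 v (α 1))⟩

theorem mul_mem_coherentElements (α : ∀ i, A i →ₐc[k] B) {f g : CompletedTensor k (∀ i, A i)}
    (hf : f ∈ coherentElements α) (hg : g ∈ coherentElements α) : f * g ∈ coherentElements α :=
  ⟨mul_mem_cofree hf.1 hg.1,
    fun p q u i v => (isAlgebraMap_comul_comp₁ u i v).eq_mul (isAlgebraMap_comp₂ u i v)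
      (hf.2.1 p q u i v) (hg.2.1 p q u i v),
    fun p q u i v => (isAlgebraMap_counit_comp₁ u i v).eq_mul (isAlgebraMap_comp₀ u v)
      (hf.2.2.1 p q u i v) (hg.2.2.1 p q u i v),
    fun p q u v => (isAlgebraMap_bialgHom_comp₁ u 0 v (α 0)).eq_mul
      (isAlgebraMap_bialgHom_comp₁ u 1 v (α 1)) (hf.2.2.2 p q u v) (hg.2.2.2 p q u v)⟩

/-- The relations between words that coherence imposes on word functionals: `CoherenceRel α r s`
expresses that a coherent element takes the same value at `r` and at `s`, also when
both are extended by the same words on either side. -/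
inductive CoherenceRel (α : ∀ i, A i →ₐc[k] B) :
    FreeMonoid (Module.Dual k (∀ i, A i)) → FreeMonoid (Module.Dual k (∀ i, A i)) → Prop
  /-- Multiplicative coherence. -/
  | comul (i : Fin 2) (c d : Module.Dual k (A i)) : CoherenceRel α
      (FreeMonoid.of ((pairing c d ∘ₗ Coalgebra.comul) ∘ₗ LinearMap.proj i))
      (FreeMonoid.of (c ∘ₗ LinearMap.proj i) * FreeMonoid.of (d ∘ₗ LinearMap.proj i))
  /-- Unital coherence. -/
  | counit (i : Fin 2) : CoherenceRel α
      (FreeMonoid.of (Coalgebra.counit (A := A i) ∘ₗ LinearMap.proj i)) 1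
  /-- Coherence over `B`. -/
  | over (c : Module.Dual k B) : CoherenceRel α
      (FreeMonoid.of ((c ∘ₗ (α 0 : A 0 →ₗ[k] B)) ∘ₗ LinearMap.proj 0))
      (FreeMonoid.of ((c ∘ₗ (α 1 : A 1 →ₗ[k] B)) ∘ₗ LinearMap.proj 1))

/-- Coherence is invariance of the word functionals under two-sided substitution of subwords. -/
theorem mem_coherentElements_iff (α : ∀ i, A i →ₐc[k] B) (f : CompletedTensor k (∀ i, A i)) :
    f ∈ coherentElements α ↔ f ∈ cofree k (∀ i, A i) ∧
      ∀ r s, CoherenceRel α r s → ∀ l m,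
        wordDual k _ (l * r * m) f = wordDual k _ (l * s * m) f := by
  refine and_congr_right fun _ => ?_
  rw [isMultiplicativelyCoherent_iff, isUnitallyCoherent_iff, isCoherentOver_iff]
  constructor
  · rintro ⟨h1, h2, h3⟩ _ _ (⟨i, c, d⟩ | i | c) l m
    · rw [h1, mul_assoc l]
    · rw [h2, mul_one]
    · exact h3 l m c
  · intro h
    refine ⟨fun l m i c d => ?_, fun l m i => ?_, fun l m c => h _ _ (.over c) l m⟩
    · simpa only [mul_assoc] using h _ _ (.comul i c d) l m
    · rw [h _ _ (.counit i), mul_one]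

theorem add_mem_coherentElements (α : ∀ i, A i →ₐc[k] B) {f g : CompletedTensor k (∀ i, A i)}
    (hf : f ∈ coherentElements α) (hg : g ∈ coherentElements α) : f + g ∈ coherentElements α := by
  rw [mem_coherentElements_iff, mem_cofree_iff] at *
  obtain ⟨⟨s, hs⟩, hf⟩ := hf
  obtain ⟨⟨t, ht⟩, hg⟩ := hg
  exact ⟨⟨s + t, fun l m => by rw [map_add, map_add, hs, ht]⟩,
    fun r s h l m => by rw [map_add, map_add, hf r s h, hg r s h]⟩

theorem smul_mem_coherentElements (α : ∀ i, A i →ₐc[k] B) (c : k)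
    {f : CompletedTensor k (∀ i, A i)} (hf : f ∈ coherentElements α) :
    c • f ∈ coherentElements α := by
  rw [mem_coherentElements_iff, mem_cofree_iff] at *
  obtain ⟨⟨s, hs⟩, hf⟩ := hf
  exact ⟨⟨c • s, fun l m => by rw [map_smul, map_smul, hs]⟩,
    fun r s h l m => by rw [map_smul, map_smul, hf r s h]⟩

/-- The coherent elements of `C(A 0 ⊕ A 1)` as a subalgebra of the completed tensor space. -/
def coherentSubalgebra (α : ∀ i, A i →ₐc[k] B) :
    Subalgebra k (CompletedTensor k (∀ i, A i)) where
  carrier := coherentElements α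
  mul_mem' := mul_mem_coherentElements α
  add_mem' := add_mem_coherentElements α
  algebraMap_mem' c := by
    rw [Algebra.algebraMap_eq_smul_one]
    exact smul_mem_coherentElements α c (one_mem_coherentElements α)

end Components

end AlgebraMaps

/-! ### The bialgebra of coherent elements -/

section MatrixCoefficients

variable {k K M : Type*} [Field k] [AddCommMonoid K] [Module k K] [Monoid M]
  {F : M → Module.Dual k K}

/-- The comultiplication dual to the product of a monoid `M` of functionals. -/
noncomputable def comulOfSeparating (hF : Separating F)
    (h : ∀ f, ∃ t : K ⊗[k] K, ∀ l m, pairing (F l) (F m) t = F (l * m) f) : K →ₗ[k] K ⊗[k] K where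
  toFun f := (h f).choose
  map_add' f g := hF.pairing hF fun ⟨l, m⟩ => by
    dsimp only
    rw [map_add, (h f).choose_spec, (h g).choose_spec, (h (f + g)).choose_spec, map_add]
  map_smul' c f := hF.pairing hF fun ⟨l, m⟩ => by
    dsimp only
    rw [map_smul, (h f).choose_spec, (h (c • f)).choose_spec, map_smul]
    rfl

theorem pairing_comulOfSeparating (hF : Separating F)
    (h : ∀ f, ∃ t : K ⊗[k] K, ∀ l m, pairing (F l) (F m) t = F (l * m) f) (l m : M) (f : K) :
    pairing (F l) (F m) (comulOfSeparating hF h f) = F (l * m) f :=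
  (h f).choose_spec l m

/-- A vector space with a separating family of functionals indexed by a monoid is a coalgebra as
soon as every vector is representative, that is, as soon as the functions `(l, m) ↦ F (l * m) f` are
matrix coefficients. Its counit is the functional attached to `1`. -/
@[reducible]
noncomputable def coalgebraOfSeparating (hF : Separating F)
    (h : ∀ f, ∃ t : K ⊗[k] K, ∀ l m, pairing (F l) (F m) t = F (l * m) f) : Coalgebra k K where
  comul := comulOfSeparating hF h
  counit := F 1
  coassoc := by
    have key (l m : M) : pairing (F l) (F m) ∘ₗ comulOfSeparating hF h = F (l * m) :=
      LinearMap.ext (pairing_comulOfSeparating hF h l m)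
    refine LinearMap.ext fun f => hF.pairing (hF.pairing hF) fun ⟨l, m, n⟩ => ?_
    simp only [LinearMap.comp_apply, LinearEquiv.coe_coe, pairing_assoc, pairing_rTensor,
      pairing_lTensor, key, pairing_comulOfSeparating, mul_assoc]
  rTensor_counit_comp_comul := by
    refine LinearMap.ext fun f => separating_id.pairing hF fun ⟨_, m⟩ => ?_
    change pairing LinearMap.id (F m) ((F 1).rTensor K (comulOfSeparating hF h f)) =
      pairing LinearMap.id (F m) (1 ⊗ₜ f)
    rw [pairing_rTensor, LinearMap.id_comp, pairing_comulOfSeparating, one_mul, pairing_tmul,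
      LinearMap.id_apply, one_mul]
  lTensor_counit_comp_comul := by
    refine LinearMap.ext fun f => hF.pairing separating_id fun ⟨m, _⟩ => ?_
    change pairing (F m) LinearMap.id ((F 1).lTensor K (comulOfSeparating hF h f)) =
      pairing (F m) LinearMap.id (f ⊗ₜ 1)
    rw [pairing_lTensor, LinearMap.id_comp, pairing_comulOfSeparating, mul_one, pairing_tmul,
      LinearMap.id_apply, mul_one]

end MatrixCoefficients

section Bialgebra

variable {k : Type*} [Field k] {A : Fin 2 → Type*} [∀ i, CommRing (A i)] [∀ i, HopfAlgebra k (A i)]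
  {B : Type*} [CommRing B] [HopfAlgebra k B] (α : ∀ i, A i →ₐc[k] B)

/-- The restriction of a word functional to the coherent elements. -/
noncomputable def coherentDual (l : FreeMonoid (Module.Dual k (∀ i, A i))) :
    Module.Dual k (coherentSubalgebra α) :=
  wordDual k _ l ∘ₗ (coherentSubalgebra α).val.toLinearMap

theorem separating_coherentDual : Separating (coherentDual α) :=
  fun _ _ hf => Subtype.ext (separating_wordDual k _ hf)

theorem exists_comul_coherent (f : coherentSubalgebra α) :
    ∃ t : coherentSubalgebra α ⊗[k] coherentSubalgebra α,
      ∀ l m, pairing (coherentDual α l) (coherentDual α m) t = coherentDual α (l * m) f := by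
  refine exists_comul_of_translate (coherentSubalgebra α).toSubmodule (fun f hf => hf.1)
    (fun f hf g m hg => ?_) (fun f hf g m hg => ?_) f
  · have hf' := (mem_coherentElements_iff α f).1 hf
    refine (mem_coherentElements_iff α g).2 ⟨mem_cofree_of_translate_right hf'.1 m hg, ?_⟩
    intro r s h l l'
    simpa only [hg, mul_assoc] using hf'.2 r s h l (l' * m)
  · have hf' := (mem_coherentElements_iff α f).1 hf
    refine (mem_coherentElements_iff α g).2 ⟨mem_cofree_of_translate_left hf'.1 m hg, ?_⟩
    intro r s h l l'
    simpa only [hg, mul_assoc] using hf'.2 r s h (m * l) l'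

noncomputable instance : Coalgebra k (coherentSubalgebra α) :=
  coalgebraOfSeparating (separating_coherentDual α) (exists_comul_coherent α)

theorem pairing_comul_coherent (l m : FreeMonoid (Module.Dual k (∀ i, A i)))
    (f : coherentSubalgebra α) :
    pairing (coherentDual α l) (coherentDual α m) (Coalgebra.comul f) = coherentDual α (l * m) f :=
  pairing_comulOfSeparating (separating_coherentDual α) (exists_comul_coherent α) l m f

theorem counit_coherent (f : coherentSubalgebra α) :
    Coalgebra.counit (R := k) f = coherentDual α 1 f := rfl

/-- The degree `n` component of a coherent element. -/
noncomputable def component (n : ℕ) : coherentSubalgebra α →ₐ[k] ⨂[k]^n (∀ i, A i) :=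
  (Pi.evalAlgHom k (fun n => ⨂[k]^n (∀ i, A i)) n).comp (coherentSubalgebra α).val

theorem tensorDual_component {n : ℕ} (a : Fin n → Module.Dual k (∀ i, A i)) :
    tensorDual a ∘ₗ (component α n).toLinearMap = coherentDual α (word a) :=
  LinearMap.ext fun f => (wordDual_word a f.1).symm

theorem separating_component : Separating fun n => (component α n).toLinearMap :=
  fun _ _ hf => Subtype.ext (funext hf)

theorem map_component_comul (f : coherentSubalgebra α) (p q : ℕ) :
    TensorProduct.map (component α p).toLinearMap (component α q).toLinearMap
      (Coalgebra.comul f) = split k _ p q (f.1 (p + q)) := by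
  refine (separating_tensorDual p).pairing (separating_tensorDual q) fun ⟨a, b⟩ => ?_
  rw [pairing_map, tensorDual_component, tensorDual_component, pairing_comul_coherent,
    ← wordDual_mul]
  rfl

theorem isAlgebraMap_tensorDual_zero {V : Type*} [CommRing V] [Algebra k V]
    (a : Fin 0 → Module.Dual k V) : IsAlgebraMap (tensorDual a) :=
  IsAlgebraMap.of_tprod (by simp) (by simp)

theorem isAlgebraMap_counit_coherent :
    IsAlgebraMap (Coalgebra.counit (R := k) (A := coherentSubalgebra α)) :=
  (isAlgebraMap_tensorDual_zero _).comp (IsAlgebraMap.of_algHom (component α 0))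

theorem isAlgebraMap_map_component (p q : ℕ) :
    IsAlgebraMap (TensorProduct.map (component α p).toLinearMap (component α q).toLinearMap) :=
  (IsAlgebraMap.of_algHom (component α p)).tensorMap (IsAlgebraMap.of_algHom (component α q))

theorem isAlgebraMap_comul_coherent :
    IsAlgebraMap (Coalgebra.comul (R := k) (A := coherentSubalgebra α)) := by
  have hs := (separating_component α).map (separating_component α)
  refine ⟨hs fun ⟨p, q⟩ => ?_, fun f g => hs fun ⟨p, q⟩ => ?_⟩
  · refine (map_component_comul α _ p q).trans
      (Eq.trans ?_ (isAlgebraMap_map_component α p q).map_one.symm)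
    exact (isAlgebraMap_split k _ p q).map_one
  · refine (map_component_comul α _ p q).trans
      (Eq.trans ?_ ((isAlgebraMap_map_component α p q).map_mul _ _).symm)
    rw [map_component_comul, map_component_comul]
    exact (isAlgebraMap_split k _ p q).map_mul _ _

noncomputable instance : Bialgebra k (coherentSubalgebra α) :=
  Bialgebra.mk' k _ (isAlgebraMap_counit_coherent α).map_one
    ((isAlgebraMap_counit_coherent α).map_mul _ _) (isAlgebraMap_comul_coherent α).map_one
    ((isAlgebraMap_comul_coherent α).map_mul _ _)

end Bialgebra

open WithConv

/-! ### Convolution and antipodes -/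

section Convolution

variable {k : Type*} [Field k] {C R S : Type*} [AddCommMonoid C] [Module k C] [Coalgebra k C]
  [Semiring R] [Algebra k R] [Semiring S] [Algebra k S]

/-- Composition with an algebra map is multiplicative for convolution. -/
theorem toConv_algHom_comp_mul (h : R →ₐ[k] S) (f g : WithConv (C →ₗ[k] R)) :
    toConv (h.toLinearMap ∘ₗ f.ofConv) * toConv (h.toLinearMap ∘ₗ g.ofConv) =
      toConv (h.toLinearMap ∘ₗ (f * g).ofConv) :=
  WithConv.ext (LinearMap.algHom_comp_convMul_distrib h f g).symm

theorem toConv_algHom_comp_one (h : R →ₐ[k] S) :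
    toConv (h.toLinearMap ∘ₗ (1 : WithConv (C →ₗ[k] R)).ofConv) = 1 := by
  ext c; simp

/-- The map `(f ⊗ g) ∘ Δ` is the convolution product of `f ⊗ 1` and `1 ⊗ g`. -/
theorem map_comp_comul_eq (f : C →ₗ[k] R) (g : C →ₗ[k] S) :
    toConv (TensorProduct.map f g ∘ₗ Coalgebra.comul) =
      toConv ((Algebra.TensorProduct.includeLeft : R →ₐ[k] R ⊗[k] S).toLinearMap ∘ₗ f) *
      toConv ((Algebra.TensorProduct.includeRight : S →ₐ[k] R ⊗[k] S).toLinearMap ∘ₗ g) := by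
  rw [LinearMap.convMul_def, TensorProduct.map_comp, ← LinearMap.comp_assoc,
    ← LinearMap.comp_assoc]
  congr 2
  ext x y
  simp

/-- Swapping the factors of `Δ` reverses the convolution product. -/
theorem map_comm_comp_comul_eq (f : C →ₗ[k] R) (g : C →ₗ[k] S) :
    toConv (TensorProduct.map f g ∘ₗ (TensorProduct.comm k C C).toLinearMap ∘ₗ Coalgebra.comul) =
      toConv ((Algebra.TensorProduct.includeRight : S →ₐ[k] R ⊗[k] S).toLinearMap ∘ₗ g) *
      toConv ((Algebra.TensorProduct.includeLeft : R →ₐ[k] R ⊗[k] S).toLinearMap ∘ₗ f) := by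
  rw [LinearMap.convMul_def, TensorProduct.map_comp, ← LinearMap.comp_assoc,
    ← LinearMap.comp_assoc, ← LinearMap.comp_assoc]
  congr 2
  ext x y
  simp

end Convolution

section HopfAlgebra

variable {k : Type*} [Field k] {H : Type*} [CommRing H] [HopfAlgebra k H]

/-- The antipode of a Hopf algebra reverses the comultiplication. -/
theorem comul_antipode (a : H) :
    Coalgebra.comul (HopfAlgebra.antipode k a) =
      TensorProduct.comm k H H (TensorProduct.map (HopfAlgebra.antipode k) (HopfAlgebra.antipode k)
        (Coalgebra.comul a)) := by
  let i₁ : WithConv (H →ₐ[k] H ⊗[k] H) := toConv Algebra.TensorProduct.includeLeft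
  let i₂ : WithConv (H →ₐ[k] H ⊗[k] H) := toConv Algebra.TensorProduct.includeRight
  -- algebra maps out of `H` form a group under convolution, with inverse `- ∘ S`; the claim is
  -- `Δ⁻¹ = (i₁ i₂)⁻¹ = i₂⁻¹ i₁⁻¹`
  have h : toConv (Bialgebra.comulAlgHom k H) = i₁ * i₂ := by
    apply WithConv.ofConv_injective
    apply AlgHom.toLinearMap_injective
    apply WithConv.toConv_injective
    rw [AlgHom.toLinearMap_convMul]
    refine Eq.trans ?_ (map_comp_comul_eq LinearMap.id LinearMap.id)
    rw [TensorProduct.map_id]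
    rfl
  have h' : (toConv (Bialgebra.comulAlgHom k H))⁻¹ = i₂⁻¹ * i₁⁻¹ := by
    rw [h]
    exact mul_inv_rev i₁ i₂
  have h'' := congr(($h').ofConv.toLinearMap)
  have h3 := map_comm_comp_comul_eq (HopfAlgebra.antipode k (A := H)) (HopfAlgebra.antipode k)
  have h4 := congr(($h3).ofConv a)
  rw [← TensorProduct.map_comm]
  refine Eq.trans ?_ h4.symm
  exact congr($h'' a)

theorem pairing_comul_antipode (c d : Module.Dual k H) :
    (pairing c d ∘ₗ Coalgebra.comul) ∘ₗ HopfAlgebra.antipode k =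
      pairing (d ∘ₗ HopfAlgebra.antipode k) (c ∘ₗ HopfAlgebra.antipode k) ∘ₗ Coalgebra.comul := by
  refine LinearMap.ext fun a => ?_
  simp only [LinearMap.comp_apply, comul_antipode, pairing_comm, pairing_map]

variable {H' : Type*} [CommRing H'] [HopfAlgebra k H']

theorem toConv_antipode_comp_mul {C : Type*} [AddCommMonoid C] [Module k C] [Coalgebra k C]
    (p : C →ₗc[k] H) :
    toConv (HopfAlgebra.antipode k ∘ₗ p.toLinearMap) * toConv p.toLinearMap = 1 := by
  have := LinearMap.convMul_comp_coalgHom_distrib (toConv (HopfAlgebra.antipode k (A := H)))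
    (toConv LinearMap.id) p
  rw [LinearMap.antipode_mul_id] at this
  refine WithConv.ext (this.symm.trans ?_)
  ext c
  simp

theorem toConv_mul_antipode_comp {C : Type*} [AddCommMonoid C] [Module k C] [Coalgebra k C]
    (p : C →ₗc[k] H) :
    toConv p.toLinearMap * toConv (HopfAlgebra.antipode k ∘ₗ p.toLinearMap) = 1 := by
  have := LinearMap.convMul_comp_coalgHom_distrib (toConv LinearMap.id)
    (toConv (HopfAlgebra.antipode k (A := H))) p
  rw [LinearMap.id_mul_antipode] at this
  refine WithConv.ext (this.symm.trans ?_)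
  ext c
  simp

/-- Morphisms of bialgebras commute with antipodes: both composites are convolution inverse to
the morphism. -/
theorem bialgHom_comp_antipode (β : H →ₐc[k] H') :
    (β : H →ₗ[k] H') ∘ₗ HopfAlgebra.antipode k = HopfAlgebra.antipode k ∘ₗ (β : H →ₗ[k] H') := by
  have h1 := toConv_antipode_comp_mul (β : H →ₗc[k] H')
  have h2 := toConv_algHom_comp_mul (β : H →ₐ[k] H') (toConv (LinearMap.id (R := k) (M := H)))
    (toConv (HopfAlgebra.antipode k))
  rw [LinearMap.id_mul_antipode, toConv_algHom_comp_one] at h2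
  exact congr(($(left_inv_eq_right_inv h1 h2)).ofConv).symm

end HopfAlgebra

/-! ### The antipode and the degree one projections -/

section Antipode

variable {k : Type*} [Field k] {A : Fin 2 → Type*} [∀ i, CommRing (A i)] [∀ i, HopfAlgebra k (A i)]
  {B : Type*} [CommRing B] [HopfAlgebra k B]

variable (k A) in
/-- The antipodes of `A 0` and `A 1`, acting on `A 0 ⊕ A 1`. -/
noncomputable def antipodePi : (∀ i, A i) →ₗ[k] (∀ i, A i) :=
  LinearMap.pi fun i => HopfAlgebra.antipode k (A := A i) ∘ₗ LinearMap.proj i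

/-- The anti-automorphism of words dual to the antipode: it composes the letters with the
antipodes and reverses their order. -/
noncomputable def antipodeWord (l : FreeMonoid (Module.Dual k (∀ i, A i))) :
    FreeMonoid (Module.Dual k (∀ i, A i)) :=
  (FreeMonoid.map (fun c => c ∘ₗ antipodePi k A) l).reverse

theorem antipodeWord_mul (l m : FreeMonoid (Module.Dual k (∀ i, A i))) :
    antipodeWord (l * m) = antipodeWord m * antipodeWord l := by
  rw [antipodeWord, map_mul, FreeMonoid.reverse_mul]; rfl

theorem antipodeWord_of (c : Module.Dual k (∀ i, A i)) :
    antipodeWord (FreeMonoid.of c) = FreeMonoid.of (c ∘ₗ antipodePi k A) := rfl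

theorem antipodeWord_word {n : ℕ} (a : Fin n → Module.Dual k (∀ i, A i)) :
    antipodeWord (word a) = word fun j => a (Fin.rev j) ∘ₗ antipodePi k A := by
  have h : ((List.ofFn a).map fun c => c ∘ₗ antipodePi k A).reverse =
      List.ofFn fun j => a (Fin.rev j) ∘ₗ antipodePi k A := by
    refine List.ext_getElem (by simp) fun i hi hi' => ?_
    simp only [List.getElem_reverse, List.getElem_map, List.getElem_ofFn, List.length_map,
      List.length_ofFn]
    congr 2
    ext
    simp [Fin.val_rev]
    omega
  exact h

theorem tensorDual_antipodeRev {n : ℕ} (a : Fin n → Module.Dual k (∀ i, A i)) :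
    tensorDual a ∘ₗ antipodeRev k A n =
      tensorDual fun j => a (Fin.rev j) ∘ₗ antipodePi k A := by
  refine PiTensorProduct.ext (MultilinearMap.ext fun x => ?_)
  simp only [LinearMap.compMultilinearMap_apply, LinearMap.comp_apply, antipodeRev,
    PiTensorProduct.map_tprod, LinearEquiv.coe_coe, PiTensorProduct.reindex_tprod,
    tensorDual_tprod]
  refine (Fintype.prod_equiv Fin.revPerm _ _ fun j => ?_)
  simp
  rfl

variable (k A) in
/-- The antipode on the completed tensor space. -/
noncomputable def antipodeCompleted :
    CompletedTensor k (∀ i, A i) →ₗ[k] CompletedTensor k (∀ i, A i) :=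
  LinearMap.pi fun n => antipodeRev k A n ∘ₗ LinearMap.proj n

theorem wordDual_antipode (l : FreeMonoid (Module.Dual k (∀ i, A i)))
    (f : CompletedTensor k (∀ i, A i)) :
    wordDual k _ l (antipodeCompleted k A f) = wordDual k _ (antipodeWord l) f := by
  obtain ⟨n, a, rfl⟩ := exists_word l
  rw [antipodeWord_word, wordDual_word, wordDual_word, ← tensorDual_antipodeRev]
  rfl

theorem comp_proj_comp_antipodePi {i : Fin 2} (c : Module.Dual k (A i)) :
    (c ∘ₗ LinearMap.proj i) ∘ₗ antipodePi k A =
      (c ∘ₗ HopfAlgebra.antipode k) ∘ₗ LinearMap.proj i := rfl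

theorem CoherenceRel.antipodeWord {α : ∀ i, A i →ₐc[k] B}
    {r s : FreeMonoid (Module.Dual k (∀ i, A i))} (h : CoherenceRel α r s) :
    CoherenceRel α (antipodeWord r) (antipodeWord s) := by
  obtain ⟨i, c, d⟩ | i | c := h
  · rw [antipodeWord_mul, antipodeWord_of, antipodeWord_of, antipodeWord_of,
      comp_proj_comp_antipodePi, comp_proj_comp_antipodePi, comp_proj_comp_antipodePi,
      pairing_comul_antipode]
    exact .comul i _ _
  · rw [antipodeWord_of, comp_proj_comp_antipodePi, HopfAlgebra.counit_comp_antipode]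
    exact .counit i
  · have hα (i : Fin 2) : (c ∘ₗ (α i : A i →ₗ[k] B)) ∘ₗ HopfAlgebra.antipode k =
        (c ∘ₗ HopfAlgebra.antipode k) ∘ₗ (α i : A i →ₗ[k] B) := by
      rw [LinearMap.comp_assoc, bialgHom_comp_antipode, ← LinearMap.comp_assoc]
    rw [antipodeWord_of, antipodeWord_of, comp_proj_comp_antipodePi, comp_proj_comp_antipodePi,
      hα, hα]
    exact .over _

theorem antipode_mem_cofree {f : CompletedTensor k (∀ i, A i)} (hf : f ∈ cofree k (∀ i, A i)) :
    antipodeCompleted k A f ∈ cofree k (∀ i, A i) := by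
  obtain ⟨t, ht⟩ := (mem_cofree_iff _).1 hf
  refine (mem_cofree_iff _).2 ⟨TensorProduct.comm k _ _
    (TensorProduct.map (antipodeCompleted k A) (antipodeCompleted k A) t), fun l m => ?_⟩
  have h (l : FreeMonoid (Module.Dual k (∀ i, A i))) :
      wordDual k _ l ∘ₗ antipodeCompleted k A = wordDual k _ (antipodeWord l) :=
    LinearMap.ext (wordDual_antipode l)
  rw [pairing_comm, pairing_map, h, h, ht, wordDual_antipode, antipodeWord_mul]

variable (α : ∀ i, A i →ₐc[k] B)

theorem antipode_mem_coherentElements {f : CompletedTensor k (∀ i, A i)}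
    (hf : f ∈ coherentElements α) : antipodeCompleted k A f ∈ coherentElements α := by
  rw [mem_coherentElements_iff] at *
  refine ⟨antipode_mem_cofree hf.1, fun r s h l m => ?_⟩
  simpa only [wordDual_antipode, antipodeWord_mul, mul_assoc] using
    hf.2 _ _ h.antipodeWord (antipodeWord m) (antipodeWord l)

/-- The antipode on the coherent elements. -/
noncomputable def coherentAntipode : coherentSubalgebra α →ₗ[k] coherentSubalgebra α where
  toFun f := ⟨antipodeCompleted k A f.1, antipode_mem_coherentElements α f.2⟩
  map_add' f g := Subtype.ext (map_add (antipodeCompleted k A) f.1 g.1)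
  map_smul' c f := Subtype.ext (map_smul (antipodeCompleted k A) c f.1)

theorem coherentDual_comp_antipode (l : FreeMonoid (Module.Dual k (∀ i, A i))) :
    coherentDual α l ∘ₗ coherentAntipode α = coherentDual α (antipodeWord l) :=
  LinearMap.ext fun f => wordDual_antipode l f.1

theorem comul_coherentAntipode :
    Coalgebra.comul ∘ₗ coherentAntipode α =
      TensorProduct.map (coherentAntipode α) (coherentAntipode α) ∘ₗ
        (TensorProduct.comm k _ _).toLinearMap ∘ₗ Coalgebra.comul := by
  refine LinearMap.ext fun f =>
    (separating_coherentDual α).pairing (separating_coherentDual α) fun ⟨l, m⟩ => ?_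
  simp only [LinearMap.comp_apply, LinearEquiv.coe_coe, pairing_map, pairing_comm,
    coherentDual_comp_antipode, pairing_comul_coherent, ← antipodeWord_mul]
  exact congr($(coherentDual_comp_antipode α (l * m)) f)

variable (k A) in
/-- The projection of `(A 0 ⊕ A 1)^{⊗1}` onto `A i`, as a map of algebras. -/
noncomputable def degreeOneProj (i : Fin 2) : (⨂[k]^1 (∀ i, A i)) →ₐ[k] A i :=
  (Pi.evalAlgHom k A i).comp (AlgHom.ofLinearMap (degreeOne k (∀ i, A i))
    (isAlgebraMap_degreeOne k _).map_one (isAlgebraMap_degreeOne k _).map_mul)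

theorem separating_degreeOneProj : Separating fun i => (degreeOneProj k A i).toLinearMap :=
  fun _ _ h => (PiTensorProduct.subsingletonEquiv (R := k) (s := fun _ : Fin 1 => ∀ i, A i)
    0).injective (funext h)

/-- The degree one projection from the coherent elements to `A i`, as a map of algebras. -/
noncomputable def coherentProjAlgHom (i : Fin 2) : coherentSubalgebra α →ₐ[k] A i :=
  (degreeOneProj k A i).comp (component α 1)

theorem dual_coherentProj (i : Fin 2) (c : Module.Dual k (A i)) :
    c ∘ₗ (coherentProjAlgHom α i).toLinearMap =
      coherentDual α (FreeMonoid.of (c ∘ₗ LinearMap.proj i)) :=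
  LinearMap.ext fun f => (wordDual_of (c ∘ₗ LinearMap.proj i) f.1).symm

theorem coherentDual_eq_of_rel {r s : FreeMonoid (Module.Dual k (∀ i, A i))}
    (h : CoherenceRel α r s) : coherentDual α r = coherentDual α s :=
  LinearMap.ext fun f => by
    have := ((mem_coherentElements_iff α f.1).1 f.2).2 r s h 1 1
    simp only [one_mul, mul_one] at this
    exact this

/-- The degree one projection from the coherent elements to `A i`, as a map of bialgebras. -/
noncomputable def coherentProj (i : Fin 2) : coherentSubalgebra α →ₐc[k] A i :=
  BialgHom.ofAlgHom (coherentProjAlgHom α i)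
    (AlgHom.toLinearMap_injective
      ((dual_coherentProj α i _).trans (coherentDual_eq_of_rel α (.counit i))))
    (AlgHom.toLinearMap_injective <| LinearMap.ext fun f =>
      (separating_dual (k := k) (M := A i)).pairing (separating_dual (k := k) (M := A i))
        fun ⟨c, d⟩ => by
        change pairing c d (TensorProduct.map (coherentProjAlgHom α i).toLinearMap
          (coherentProjAlgHom α i).toLinearMap (Coalgebra.comul f)) =
            ((pairing c d ∘ₗ Coalgebra.comul) ∘ₗ (coherentProjAlgHom α i).toLinearMap) f
        rw [pairing_map, dual_coherentProj, dual_coherentProj, dual_coherentProj,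
          pairing_comul_coherent, coherentDual_eq_of_rel α (.comul i c d)])

theorem coherentProj_antipode (i : Fin 2) :
    (coherentProjAlgHom α i).toLinearMap ∘ₗ coherentAntipode α =
      HopfAlgebra.antipode k ∘ₗ (coherentProjAlgHom α i).toLinearMap := by
  refine LinearMap.ext fun f => separating_dual (k := k) (M := A i) fun c => ?_
  change ((c ∘ₗ (coherentProjAlgHom α i).toLinearMap) ∘ₗ coherentAntipode α) f =
    ((c ∘ₗ HopfAlgebra.antipode k) ∘ₗ (coherentProjAlgHom α i).toLinearMap) f
  rw [dual_coherentProj, dual_coherentProj, coherentDual_comp_antipode, antipodeWord_of,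
    comp_proj_comp_antipodePi]

end Antipode

/-! ### The Hopf algebra of coherent elements -/

section ConvolutionInverse

variable {k : Type*} [Field k] {C R S : Type*} [AddCommMonoid C] [Module k C] [Coalgebra k C]
  [Semiring R] [Algebra k R] [Semiring S] [Algebra k S]

/-- A separating family of algebra maps detects convolution inverses. -/
theorem toConv_mul_eq_one_of_separating {ι : Type*} {T : ι → Type*} [∀ i, Semiring (T i)]
    [∀ i, Algebra k (T i)] (h : ∀ i, R →ₐ[k] T i) (hs : Separating fun i => (h i).toLinearMap)
    {f g : C →ₗ[k] R}
    (H : ∀ i, toConv ((h i).toLinearMap ∘ₗ f) * toConv ((h i).toLinearMap ∘ₗ g) = 1) :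
    toConv f * toConv g = 1 := by
  refine WithConv.ext (LinearMap.ext fun c => hs fun i => ?_)
  have h1 := toConv_algHom_comp_mul (h i) (toConv f) (toConv g)
  have h2 := toConv_algHom_comp_one (C := C) (h i)
  exact congr(($(h1.symm.trans ((H i).trans h2.symm))).ofConv c)

/-- Convolution inverses of `f` and `g` give one of `(f ⊗ g) ∘ Δ`, with the factors swapped. -/
theorem toConv_map_comm_comp_comul_mul {f f' : C →ₗ[k] R} {g g' : C →ₗ[k] S}
    (hf : toConv f' * toConv f = 1) (hg : toConv g' * toConv g = 1) :
    toConv (TensorProduct.map f' g' ∘ₗ (TensorProduct.comm k C C).toLinearMap ∘ₗ Coalgebra.comul) *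
      toConv (TensorProduct.map f g ∘ₗ Coalgebra.comul) = 1 := by
  rw [map_comm_comp_comul_eq, map_comp_comul_eq, mul_assoc, ← mul_assoc (toConv (_ ∘ₗ f')),
    toConv_algHom_comp_mul _ (toConv f') (toConv f), hf, toConv_algHom_comp_one, one_mul,
    toConv_algHom_comp_mul _ (toConv g') (toConv g), hg, toConv_algHom_comp_one]

theorem toConv_mul_map_comm_comp_comul {f f' : C →ₗ[k] R} {g g' : C →ₗ[k] S}
    (hf : toConv f * toConv f' = 1) (hg : toConv g * toConv g' = 1) :
    toConv (TensorProduct.map f g ∘ₗ Coalgebra.comul) *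
      toConv (TensorProduct.map f' g' ∘ₗ (TensorProduct.comm k C C).toLinearMap ∘ₗ
        Coalgebra.comul) = 1 := by
  rw [map_comm_comp_comul_eq, map_comp_comul_eq, mul_assoc, ← mul_assoc (toConv (_ ∘ₗ g)),
    toConv_algHom_comp_mul _ (toConv g) (toConv g'), hg, toConv_algHom_comp_one, one_mul,
    toConv_algHom_comp_mul _ (toConv f) (toConv f'), hf, toConv_algHom_comp_one]

end ConvolutionInverse

section HopfAlgebra

variable {k : Type*} [Field k] {A : Fin 2 → Type*} [∀ i, CommRing (A i)] [∀ i, HopfAlgebra k (A i)]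
  {B : Type*} [CommRing B] [HopfAlgebra k B] (α : ∀ i, A i →ₐc[k] B)

variable (k) in
/-- The isomorphism `V^{⊗(p+q)} → V^{⊗p} ⊗ V^{⊗q}`, for an algebra `V`, as a map of algebras. -/
noncomputable def splitAlgHom (V : Type*) [CommRing V] [Algebra k V] (p q : ℕ) :
    (⨂[k]^(p + q) V) →ₐ[k] (⨂[k]^p V) ⊗[k] (⨂[k]^q V) :=
  AlgHom.ofLinearMap (split k V p q) (isAlgebraMap_split k V p q).map_one
    (isAlgebraMap_split k V p q).map_mul

theorem split_comp_component (p q : ℕ) :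
    (splitAlgHom k _ p q).toLinearMap ∘ₗ (component α (p + q)).toLinearMap =
      TensorProduct.map (component α p).toLinearMap (component α q).toLinearMap ∘ₗ
        Coalgebra.comul :=
  LinearMap.ext fun f => (map_component_comul α f p q).symm

theorem split_comp_component_comp_antipode (p q : ℕ) :
    (splitAlgHom k _ p q).toLinearMap ∘ₗ (component α (p + q)).toLinearMap ∘ₗ coherentAntipode α =
      TensorProduct.map ((component α p).toLinearMap ∘ₗ coherentAntipode α)
        ((component α q).toLinearMap ∘ₗ coherentAntipode α) ∘ₗ
        (TensorProduct.comm k _ _).toLinearMap ∘ₗ Coalgebra.comul := by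
  rw [← LinearMap.comp_assoc, split_comp_component, LinearMap.comp_assoc, comul_coherentAntipode,
    ← LinearMap.comp_assoc, TensorProduct.map_comp]

theorem separating_splitAlgHom (V : Type*) [CommRing V] [Algebra k V] (p q : ℕ) :
    Separating fun _ : Unit => (splitAlgHom k V p q).toLinearMap :=
  fun _ _ h => split_injective p q (h ())

theorem toConv_component_zero : toConv (component α 0).toLinearMap = 1 := by
  refine WithConv.ext (LinearMap.ext fun f => separating_tensorDual 0 fun a => ?_)
  have h := isAlgebraMap_tensorDual_zero a
  change _ = tensorDual a (algebraMap k _ (Coalgebra.counit f))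
  rw [Algebra.algebraMap_eq_smul_one, map_smul, h.map_one, smul_eq_mul, mul_one, counit_coherent]
  change (tensorDual a ∘ₗ (component α 0).toLinearMap) f = _
  rw [tensorDual_component]
  rfl

theorem component_zero_comp_antipode :
    (component α 0).toLinearMap ∘ₗ coherentAntipode α = (component α 0).toLinearMap := by
  refine LinearMap.ext fun f => separating_tensorDual 0 fun a => ?_
  change (tensorDual a ∘ₗ (component α 0).toLinearMap) (coherentAntipode α f) =
    (tensorDual a ∘ₗ (component α 0).toLinearMap) f
  rw [tensorDual_component]
  exact congr($(coherentDual_comp_antipode α 1) f)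

theorem toConv_antipode_mul_component (n : ℕ) :
    toConv ((component α n).toLinearMap ∘ₗ coherentAntipode α) *
      toConv (component α n).toLinearMap = 1 := by
  have h1 : toConv ((component α 1).toLinearMap ∘ₗ coherentAntipode α) *
      toConv (component α 1).toLinearMap = 1 := by
    refine toConv_mul_eq_one_of_separating _ separating_degreeOneProj fun i => ?_
    have h := toConv_antipode_comp_mul (coherentProj α i).toCoalgHom
    exact congr((toConv $(coherentProj_antipode α i)) *
      toConv (coherentProjAlgHom α i).toLinearMap).trans h
  induction n with
  | zero => rw [component_zero_comp_antipode, toConv_component_zero, one_mul]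
  | succ n ih =>
    refine toConv_mul_eq_one_of_separating _ (separating_splitAlgHom _ n 1) fun _ => ?_
    rw [split_comp_component_comp_antipode, split_comp_component]
    exact toConv_map_comm_comp_comul_mul ih h1

theorem toConv_component_mul_antipode (n : ℕ) :
    toConv (component α n).toLinearMap *
      toConv ((component α n).toLinearMap ∘ₗ coherentAntipode α) = 1 := by
  have h1 : toConv (component α 1).toLinearMap *
      toConv ((component α 1).toLinearMap ∘ₗ coherentAntipode α) = 1 := by
    refine toConv_mul_eq_one_of_separating _ separating_degreeOneProj fun i => ?_
    have h := toConv_mul_antipode_comp (coherentProj α i).toCoalgHom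
    exact congr(toConv (coherentProjAlgHom α i).toLinearMap *
      toConv $(coherentProj_antipode α i)).trans h
  induction n with
  | zero => rw [component_zero_comp_antipode, toConv_component_zero, one_mul]
  | succ n ih =>
    refine toConv_mul_eq_one_of_separating _ (separating_splitAlgHom _ n 1) fun _ => ?_
    rw [split_comp_component_comp_antipode, split_comp_component]
    exact toConv_mul_map_comm_comp_comul ih h1

noncomputable instance : HopfAlgebra k (coherentSubalgebra α) where
  antipode := coherentAntipode α
  mul_antipode_rTensor_comul := by
    have := toConv_mul_eq_one_of_separating (f := coherentAntipode α) (g := LinearMap.id) _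
      (separating_component α) (toConv_antipode_mul_component α)
    exact congr(($this).ofConv)
  mul_antipode_lTensor_comul := by
    have := toConv_mul_eq_one_of_separating (f := LinearMap.id) (g := coherentAntipode α) _
      (separating_component α) (toConv_component_mul_antipode α)
    exact congr(($this).ofConv)

end HopfAlgebra

/-! ### The universal property -/

section ConvolutionWord

variable {k : Type*} [Field k] {V : Type*} [CommRing V] [Algebra k V] {D : Type*} [CommRing D]
  [Bialgebra k D]

/-- The functional on `D` attached to a word in functionals on `V` by a linear map `D → V`: the
convolution product of the pullbacks of its letters. -/
noncomputable def convWord (q : D →ₗ[k] V) :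
    FreeMonoid (Module.Dual k V) →* WithConv (D →ₗ[k] k) :=
  FreeMonoid.lift fun c => toConv (c ∘ₗ q)

theorem convWord_of (q : D →ₗ[k] V) (c : Module.Dual k V) :
    convWord q (FreeMonoid.of c) = toConv (c ∘ₗ q) := FreeMonoid.lift_eval_of _ _

theorem toConv_mul_toConv_eq_pairing (f g : D →ₗ[k] k) :
    toConv f * toConv g = toConv (pairing f g ∘ₗ Coalgebra.comul) := by
  rw [LinearMap.convMul_def]
  rfl

/-- The iterated comultiplication of `D` followed by the `n`-th tensor power of `q` is a map of
algebras `D → V^{⊗n}` that turns pure functionals into convolution products. -/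
theorem exists_algHom_tensorPower (q : D →ₐ[k] V) (n : ℕ) :
    ∃ Ψ : D →ₐ[k] ⨂[k]^n V, ∀ a : Fin n → Module.Dual k V,
      tensorDual a ∘ₗ Ψ.toLinearMap = (convWord q.toLinearMap (word a)).ofConv := by
  induction n with
  | zero =>
    refine ⟨(Algebra.ofId k _).comp (Bialgebra.counitAlgHom k D),
      fun a => LinearMap.ext fun d => ?_⟩
    change tensorDual a (algebraMap k _ (Coalgebra.counit d)) = _
    rw [Algebra.algebraMap_eq_smul_one, map_smul, (isAlgebraMap_tensorDual_zero a).map_one,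
      smul_eq_mul, mul_one]
    rfl
  | succ n ih =>
    obtain ⟨Ψ, hΨ⟩ := ih
    let s := AlgEquiv.ofBijective (splitAlgHom k V n 1) (LinearEquiv.bijective _)
    let e := AlgEquiv.ofBijective (AlgHom.ofLinearMap (degreeOne k V)
      (isAlgebraMap_degreeOne k V).map_one (isAlgebraMap_degreeOne k V).map_mul)
      (LinearEquiv.bijective _)
    refine ⟨((s.symm : _ →ₐ[k] ⨂[k]^(n + 1) V).comp (Algebra.TensorProduct.map Ψ
      ((e.symm : V →ₐ[k] ⨂[k]^1 V).comp q))).comp (Bialgebra.comulAlgHom k D), fun a =>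
        LinearMap.ext fun d => ?_⟩
    obtain ⟨b, c, rfl⟩ : ∃ (b : Fin n → Module.Dual k V) (c : Module.Dual k V),
        a = Fin.append b fun _ : Fin 1 => c :=
      ⟨fun j => a (Fin.castAdd 1 j), a (Fin.natAdd n 0), by
        conv_lhs => rw [← Fin.append_castAdd_natAdd (f := a)]
        congr 1
        ext j : 1
        rw [Subsingleton.elim j 0]⟩
    have hc : (tensorDual fun _ : Fin 1 => c) ∘ₗ (e.symm : V →ₐ[k] ⨂[k]^1 V).toLinearMap = c := by
      refine LinearMap.ext fun v => ?_
      rw [tensorDual_one]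
      exact congr(c $(e.apply_symm_apply v))
    rw [word_append, map_mul, word_const, convWord_of, tensorDual_append,
      ← toConv_ofConv (convWord q.toLinearMap (word b)), ← hΨ, toConv_mul_toConv_eq_pairing]
    change pairing _ _ (s (s.symm (TensorProduct.map Ψ.toLinearMap
      ((e.symm : V →ₐ[k] ⨂[k]^1 V).toLinearMap ∘ₗ q.toLinearMap) (Coalgebra.comul d)))) = _
    rw [s.apply_symm_apply, pairing_map, ← LinearMap.comp_assoc, hc]
    rfl

/-- The map of algebras `D → T̂V` induced by a map of algebras `D → V`. -/
noncomputable def liftCompleted (q : D →ₐ[k] V) : D →ₐ[k] CompletedTensor k V :=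
  AlgHom.pi fun n => (exists_algHom_tensorPower q n).choose

theorem wordDual_liftCompleted (q : D →ₐ[k] V) (l : FreeMonoid (Module.Dual k V)) (d : D) :
    wordDual k V l (liftCompleted q d) = (convWord q.toLinearMap l).ofConv d := by
  obtain ⟨n, a, rfl⟩ := exists_word l
  rw [wordDual_word]
  exact congr($((exists_algHom_tensorPower q n).choose_spec a) d)

theorem liftCompleted_mem_cofree (q : D →ₐ[k] V) (d : D) :
    liftCompleted q d ∈ cofree k V := by
  refine (mem_cofree_iff _).2 ⟨TensorProduct.map (liftCompleted q).toLinearMap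
    (liftCompleted q).toLinearMap (Coalgebra.comul d), fun l m => ?_⟩
  have h (l : FreeMonoid (Module.Dual k V)) : wordDual k V l ∘ₗ (liftCompleted q).toLinearMap =
      (convWord q.toLinearMap l).ofConv := LinearMap.ext (wordDual_liftCompleted q l)
  rw [pairing_map, h, h, wordDual_liftCompleted, map_mul]
  exact congr(($(toConv_mul_toConv_eq_pairing (convWord q.toLinearMap l).ofConv _)).ofConv d).symm

end ConvolutionWord

section UniversalProperty

variable {k : Type*} [Field k] {A : Fin 2 → Type*} [∀ i, CommRing (A i)] [∀ i, HopfAlgebra k (A i)]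
  {B : Type*} [CommRing B] [HopfAlgebra k B] {α : ∀ i, A i →ₐc[k] B}
  {D : Type*} [CommRing D] [Bialgebra k D]

variable (α) in
theorem comp_coherentProj : (α 0).comp (coherentProj α 0) = (α 1).comp (coherentProj α 1) := by
  refine DFunLike.ext _ _ fun f => separating_dual (k := k) (M := B) fun c => ?_
  have h (i : Fin 2) : (c ∘ₗ (α i : A i →ₗ[k] B)) ∘ₗ (coherentProjAlgHom α i).toLinearMap =
    coherentDual α _ := dual_coherentProj α i _
  exact congr($((h 0).trans ((coherentDual_eq_of_rel α (.over c)).trans (h 1).symm)) f)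

/-- The map `D → A 0 ⊕ A 1` with components `q 0` and `q 1`. -/
noncomputable def piAlgHom (q : ∀ i, D →ₐc[k] A i) : D →ₐ[k] (∀ i, A i) :=
  AlgHom.pi fun i => (q i : D →ₐ[k] A i)

theorem convWord_eq_of_rel (q : ∀ i, D →ₐc[k] A i) (hq : (α 0).comp (q 0) = (α 1).comp (q 1))
    {r s : FreeMonoid (Module.Dual k (∀ i, A i))} (h : CoherenceRel α r s) :
    convWord (piAlgHom q).toLinearMap r = convWord (piAlgHom q).toLinearMap s := by
  have hp {i : Fin 2} (c : Module.Dual k (A i)) :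
      (c ∘ₗ LinearMap.proj i) ∘ₗ (piAlgHom q).toLinearMap = c ∘ₗ (q i : D →ₗ[k] A i) := rfl
  obtain ⟨i, c, d⟩ | i | c := h
  · rw [map_mul, convWord_of, convWord_of, convWord_of, hp, hp, hp, toConv_mul_toConv_eq_pairing,
      LinearMap.comp_assoc, ← CoalgHomClass.map_comp_comul]
    exact congrArg toConv (LinearMap.ext fun x => pairing_map c d _ _ _)
  · rw [convWord_of, hp, map_one, CoalgHomClass.counit_comp]
    rfl
  · rw [convWord_of, convWord_of, hp, hp]
    exact congr(toConv (c ∘ₗ ($hq : D →ₗ[k] B)))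

/-- The map of algebras into the coherent elements induced by a cone `q`. -/
noncomputable def coherentLiftAlgHom (q : ∀ i, D →ₐc[k] A i)
    (hq : (α 0).comp (q 0) = (α 1).comp (q 1)) : D →ₐ[k] coherentSubalgebra α :=
  (liftCompleted (piAlgHom q)).codRestrict (coherentSubalgebra α) fun d =>
    (mem_coherentElements_iff α _).2 ⟨liftCompleted_mem_cofree _ d, fun r s h l m => by
      simp only [wordDual_liftCompleted, map_mul, convWord_eq_of_rel q hq h]⟩

theorem coherentDual_comp_lift (q : ∀ i, D →ₐc[k] A i)
    (hq : (α 0).comp (q 0) = (α 1).comp (q 1)) (l : FreeMonoid (Module.Dual k (∀ i, A i))) :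
    coherentDual α l ∘ₗ (coherentLiftAlgHom q hq).toLinearMap =
      (convWord (piAlgHom q).toLinearMap l).ofConv :=
  LinearMap.ext (wordDual_liftCompleted (piAlgHom q) l)

/-- The map of bialgebras into the coherent elements induced by a cone `q`. -/
noncomputable def coherentLift (q : ∀ i, D →ₐc[k] A i)
    (hq : (α 0).comp (q 0) = (α 1).comp (q 1)) : D →ₐc[k] coherentSubalgebra α :=
  BialgHom.ofAlgHom (coherentLiftAlgHom q hq)
    (AlgHom.toLinearMap_injective (coherentDual_comp_lift q hq 1))
    (AlgHom.toLinearMap_injective <| LinearMap.ext fun d =>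
      (separating_coherentDual α).pairing (separating_coherentDual α) fun ⟨l, m⟩ => by
        change pairing (coherentDual α l) (coherentDual α m)
          (TensorProduct.map (coherentLiftAlgHom q hq).toLinearMap
            (coherentLiftAlgHom q hq).toLinearMap (Coalgebra.comul d)) =
          pairing (coherentDual α l) (coherentDual α m)
            (Coalgebra.comul (coherentLiftAlgHom q hq d))
        rw [pairing_map, pairing_comul_coherent, coherentDual_comp_lift, coherentDual_comp_lift]
        refine Eq.trans ?_ congr($(coherentDual_comp_lift q hq (l * m)) d).symm
        rw [map_mul]
        exact congr(($(toConv_mul_toConv_eq_pairing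
          (convWord (piAlgHom q).toLinearMap l).ofConv _)).ofConv d).symm)

theorem coherentProj_comp_lift (q : ∀ i, D →ₐc[k] A i)
    (hq : (α 0).comp (q 0) = (α 1).comp (q 1)) (i : Fin 2) :
    (coherentProj α i).comp (coherentLift q hq) = q i := by
  refine DFunLike.ext _ _ fun d => separating_dual (k := k) (M := A i) fun c => ?_
  change ((c ∘ₗ (coherentProjAlgHom α i).toLinearMap) ∘ₗ (coherentLiftAlgHom q hq).toLinearMap) d =
    c (q i d)
  rw [dual_coherentProj, coherentDual_comp_lift, convWord_of]
  rfl

/-- Word functionals pulled back along a morphism `φ` into the coherent elements are determined by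
the composites of `φ` with the two projections. -/
theorem coherentDual_comp_eq_convWord (φ : D →ₐc[k] coherentSubalgebra α)
    (l : FreeMonoid (Module.Dual k (∀ i, A i))) :
    coherentDual α l ∘ₗ (φ : D →ₗ[k] coherentSubalgebra α) =
      (convWord (piAlgHom fun i => (coherentProj α i).comp φ).toLinearMap l).ofConv := by
  let F : FreeMonoid (Module.Dual k (∀ i, A i)) →* WithConv (D →ₗ[k] k) :=
    { toFun l := toConv (coherentDual α l ∘ₗ (φ : D →ₗ[k] coherentSubalgebra α))
      map_one' := congrArg toConv (CoalgHomClass.counit_comp φ)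
      map_mul' l m := by
        rw [toConv_mul_toConv_eq_pairing]
        refine congrArg toConv (LinearMap.ext fun d => ?_)
        refine (pairing_comul_coherent α l m (φ d)).symm.trans ?_
        rw [← CoalgHomClass.map_comp_comul_apply]
        exact pairing_map _ _ _ _ _ }
  have h : F = convWord (piAlgHom fun i => (coherentProj α i).comp φ).toLinearMap :=
    FreeMonoid.hom_eq fun c => by
      rw [convWord_of]
      refine congrArg toConv (LinearMap.ext fun d => wordDual_of c (φ d).1)
  exact congr(($h l).ofConv)

theorem existsUnique_lift (q : ∀ i, D →ₐc[k] A i) (hq : (α 0).comp (q 0) = (α 1).comp (q 1)) :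
    ∃! φ : D →ₐc[k] coherentSubalgebra α, ∀ i, (coherentProj α i).comp φ = q i := by
  refine ⟨coherentLift q hq, coherentProj_comp_lift q hq, fun φ hφ => ?_⟩
  refine DFunLike.ext _ _ fun d => separating_coherentDual α fun l => ?_
  have h := coherentDual_comp_eq_convWord φ l
  simp only [hφ] at h
  exact congr($(h.trans (coherentDual_comp_lift q hq l).symm) d)

end UniversalProperty

end HopfFibre

theorem proposition2p4 {k : Type*} [Field k]
    {A : Fin 2 → Type*} [∀ i, CommRing (A i)] [∀ i, HopfAlgebra k (A i)]
    {B : Type*} [CommRing B] [HopfAlgebra k B] (α : ∀ i, A i →ₐc[k] B) :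
    -- the coherent elements form a commutative Hopf algebra ...
    ∃ (_ : CommRing (HopfFibre.coherentElements α))
      (_ : HopfAlgebra k (HopfFibre.coherentElements α))
      -- ... which is a subalgebra of the algebra of componentwise operations,
      (ι : HopfFibre.coherentElements α →ₐ[k] HopfFibre.CompletedTensor k (∀ i, A i)),
      (∀ f, ι f = f.1) ∧
      -- whose comultiplication is deconcatenation,
      (∀ (f : HopfFibre.coherentElements α) (p q : ℕ),
        TensorProduct.map (LinearMap.proj p ∘ₗ ι.toLinearMap) (LinearMap.proj q ∘ₗ ι.toLinearMap)
          (Coalgebra.comul (R := k) f) = HopfFibre.split k (∀ i, A i) p q (f.1 (p + q))) ∧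
      -- whose counit is the degree zero component,
      (∀ f : HopfFibre.coherentElements α,
        Coalgebra.counit (R := k) f = PiTensorProduct.isEmptyEquiv (Fin 0) (f.1 0)) ∧
      -- and whose antipode applies the given antipodes factorwise and reverses the factors;
      (∀ (f : HopfFibre.coherentElements α) (n : ℕ),
        (HopfAlgebra.antipode k f).1 n = HopfFibre.antipodeRev k A n (f.1 n)) ∧
      -- the degree one component gives two morphisms of Hopf algebras `p 0` and `p 1`,
      ∃ p : ∀ i, HopfFibre.coherentElements α →ₐc[k] A i,
        (∀ i f, p i f = HopfFibre.degreeOne k (∀ i, A i) (f.1 1) i) ∧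
        -- which make the square commute and have the universal property of the fibre product.
        (α 0).comp (p 0) = (α 1).comp (p 1) ∧
        ∀ (D : Type*) [CommRing D] [HopfAlgebra k D] (q : ∀ i, D →ₐc[k] A i),
          (α 0).comp (q 0) = (α 1).comp (q 1) →
          ∃! φ : D →ₐc[k] HopfFibre.coherentElements α, ∀ i, (p i).comp φ = q i :=
  ⟨(inferInstance : CommRing (HopfFibre.coherentSubalgebra α)),
    (inferInstance : HopfAlgebra k (HopfFibre.coherentSubalgebra α)),
    (HopfFibre.coherentSubalgebra α).val, fun _ => rfl, HopfFibre.map_component_comul α,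
    fun f => HopfFibre.wordDual_one f.1, fun _ _ => rfl, HopfFibre.coherentProj α,
    fun _ _ => rfl, HopfFibre.comp_coherentProj α,
    fun _ _ _ q hq => HopfFibre.existsUnique_lift q hq⟩
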